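/- Let $C_0$ be Euler's constant, let $B_n(x)$ be the Bernoulli polynomials ($\frac{ue^{xu}}{e^u-1}=\sum_{n\ge0}B_n(x)\frac{u^n}{n!}$), and put $$\Psi(t)=\log 2\pi+\frac{\pi}{2\cosh \pi t}-\Re\frac{\Gamma'(\frac12+it)}{\Gamma(\frac12+it)},\qquad \Phi(x)=\frac1{2\pi}\int_0^\infty e^{-xt^2}\Psi(t)\,dt\quad(x>0).$$ For $a>0$ and $\Re s>1$ let $$S(s)=S_a(s)=\frac{1}{\Gamma(s/2)}\int_0^a\Phi(x)\,x^{\frac s2-1}\,dx .$$ **Theorem.** The integrals defining $\Phi(x)$ ($x>0$) and $S_a(s)$ ($a>0$, $\Re s>1$) converge absolutely. For every $a>0$ the function $S_a$ extends to a meromorphic function on $\mathbb C$ whose poles are exactly a double pole at $s=1$ and simple poles at $s=-(2n-1)$, $n=1,2,\dots$. Moreover, let $N\ge 0$ be an integer and let $s=\sigma+i\tau$ with $\sigma>-N-1$ be a point that is not one of these poles. Then, as $a\to0^+$, $$S_a(s)=\frac{a^{\frac{s-1}{2}}}{4\sqrt\pi\,\Gamma(s/2)}\Bigl\{-\frac{2}{(s-1)^2}+\frac{C_0+\log(16\pi^2a)}{s-1}+\sum_{n=1}^N\frac{B_n(3/4)}{n!}\,\frac{(4\sqrt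 a)^n\,\Gamma(n/2)}{s+n-1}\Bigr\}+O\bigl(a^{\frac{N+\sigma}{2}}\bigr),$$ where the implicit constant depends only on $s$ and $N$. If $s=1-n$ for some odd $n$ with $1\le n\le N$ (so that $1/\Gamma(s/2)$ vanishes together with the denominator $s+n-1$), the explicit expression on the right is understood as its limit at $s$, where it has a removable singularity. -/

import Mathlib

noncomputable section

namespace SecondZeta

/-- `Ψ(t) = log 2π + π / (2 cosh πt) - Re (Γ'/Γ)(1/2 + it)`. -/
def Psi (t : ℝ) : ℝ :=
  Real.log (2 * Real.pi) + Real.pi / (2 * Real.cosh (Real.pi * t))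
    - (Complex.digamma (1 / 2 + Complex.I * (t : ℂ))).re

/-- `Φ(x) = (1/2π) ∫₀^∞ e^{-x t²} Ψ(t) dt`. -/
def Phi (x : ℝ) : ℝ :=
  1 / (2 * Real.pi) * ∫ t in Set.Ioi (0 : ℝ), Real.exp (-x * t ^ 2) * Psi t

/-- The singular term `S(s) = Γ(s/2)⁻¹ ∫₀^a Φ(x) x^{s/2 - 1} dx`
(given by a convergent integral for `Re s > 1`). -/
def singularTerm (a : ℝ) (s : ℂ) : ℂ :=
  (Complex.Gamma (s / 2))⁻¹ *
    ∫ x in Set.Ioc (0 : ℝ) a, ((Phi x : ℝ) : ℂ) * (x : ℂ) ^ (s / 2 - 1)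

/-- The explicit expansion
`a^{(s-1)/2} / (4 √π Γ(s/2)) * { -2/(s-1)² + (C₀ + log 16π²a)/(s-1)
  + ∑_{n=1}^N B_n(3/4)/n! * (4√a)^n Γ(n/2) / (s+n-1) }`.
At the poles of `Γ(s/2)` the factor `1 / Γ(s/2)` evaluates to `0`, its true value. -/
def singularExpansion (N : ℕ) (a : ℝ) (s : ℂ) : ℂ :=
  (a : ℂ) ^ ((s - 1) / 2) / (4 * ((Real.sqrt Real.pi : ℝ) : ℂ) * Complex.Gamma (s / 2)) *
    (-2 / (s - 1) ^ 2
      + ((Real.eulerMascheroniConstant + Real.log (16 * Real.pi ^ 2 * a) : ℝ) : ℂ) / (s - 1)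
      + ∑ n ∈ Finset.Icc 1 N,
          (((Polynomial.bernoulli n).eval (3 / 4 : ℚ) : ℚ) : ℂ) / (n.factorial : ℂ) *
            ((((4 * Real.sqrt a) ^ n * Real.Gamma ((n : ℝ) / 2) : ℝ) : ℂ) / (s + (n : ℂ) - 1)))

end SecondZeta

end

/-! Duplication and reflection for `Γ` turn `Psi t` into `log π - Re ψ(1/4 + it/2)`. Gauss' integral
for the digamma function `ψ` then writes `Psi t` as `log π + γ + ∫ (cos (tv) weight v - planck v)
dv` over `v > 0`. Integrating against `exp (-x t²)` replaces the cosine by `exp (-v²/(4x))` up to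
the factor `√(π/x)/2` (`Phi_eq_integral`), so as `x → 0⁺` only the germ of `weight` at `0` matters.

That germ is the generating function `∑ B_n(3/4) 2^n v^(n-1) / n!`. Its polar term `1/v`, paired
with `planck`, yields the logarithm (`integral_logKernel`); the other terms are Gaussian moments and
yield powers `x^((n-1)/2)`; the remainder is `O(x^(N/2))`. This is `Phi_eq_expansion`.

Integrating this over `(0, a]` against `x^(s/2-1)` gives a double pole at `1`, terms with
denominator `s + n - 1`, and a remainder holomorphic for `Re s > -N`. Expansions of different
lengths agree where both make sense, so they glue to the continuation `extS`. The factor `1/Γ(s/2)`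
cancels the zeros of `s + n - 1` for odd `n`; for even `n ≥ 2` the pole survives because `B_n(3/4) ≠
0` (`bernoulliCoeff_two_mul_ne_zero`). For the error bound the expansion is taken one term further:
that term has exactly the size `a^((N+σ)/2)`. -/

noncomputable section

namespace SecondZeta

open Real Set Filter Topology MeasureTheory

/-! ### Gauss' integral for the digamma function -/

/-- The integrand of Gauss' formula `ψ(z) + γ = ∫₀^∞ (e^{-2v} - e^{-2zv}) 2 / (1 - e^{-2v}) dv`. -/
def gaussKernel (z : ℂ) (v : ℝ) : ℂ :=
  (Complex.exp (-(2 * v)) - Complex.exp (-(2 * z * v))) * ((2 / (1 - exp (-(2 * v))) : ℝ) : ℂ)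

lemma image_exp_neg_two_mul : (fun v : ℝ => exp (-(2 * v))) '' Ioi 0 = Ioo 0 1 := by
  ext y
  simp only [mem_image, mem_Ioi, mem_Ioo]
  constructor
  · rintro ⟨v, hv, rfl⟩
    exact ⟨exp_pos _, by rw [exp_lt_one_iff]; linarith⟩
  · rintro ⟨h0, h1⟩
    exact ⟨-log y / 2, by have := log_neg h0 h1; linarith, by
      rw [show -(2 * (-log y / 2)) = log y by ring, exp_log h0]⟩

lemma one_sub_exp_pos {v : ℝ} (hv : 0 < v) : 0 < 1 - exp (-(2 * v)) := by
  have : exp (-(2 * v)) < 1 := by rw [exp_lt_one_iff]; linarith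
  linarith

lemma hasDerivAt_exp_neg_two_mul (v : ℝ) :
    HasDerivAt (fun v : ℝ => exp (-(2 * v))) (-2 * exp (-(2 * v))) v := by
  have := ((hasDerivAt_id v).const_mul 2).neg.exp
  convert! this using 1
  simp; ring

/-- This is the substitution `y = exp (-2v)` in the Beta integral. The power `ε` of `1 - y`
regularizes the singular factor of `gaussKernel`; Gauss' formula appears as `ε → 0⁺`. -/
lemma abs_deriv_smul_beta {z : ℂ} {ε v : ℝ} (hv : 0 < v) :
    |-2 * exp (-(2 * v))| • (((exp (-(2 * v)) : ℝ) : ℂ) ^ (z - 1) *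
      (1 - ((exp (-(2 * v)) : ℝ) : ℂ)) ^ ((ε : ℂ) - 1)) =
    Complex.exp (-(2 * z * v)) * ((2 * (1 - exp (-(2 * v))) ^ (ε - 1) : ℝ) : ℂ) := by
  rw [Complex.real_smul, abs_mul, abs_of_pos (exp_pos _)]
  rw [Complex.cpow_def_of_ne_zero (by exact_mod_cast (exp_pos _).ne'), ← Complex.ofReal_log
    (exp_pos _).le, log_exp]
  have : (1 - ((exp (-(2 * v)) : ℝ) : ℂ)) ^ ((ε : ℂ) - 1) =
      (((1 - exp (-(2 * v))) ^ (ε - 1) : ℝ) : ℂ) := by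
    rw [Complex.ofReal_cpow (one_sub_exp_pos hv).le]; push_cast; rfl
  rw [this]
  have h2 : Complex.exp (-(2 * z * v)) = ((exp (-(2 * v)) : ℝ) : ℂ) *
      Complex.exp (((-(2 * v) : ℝ) : ℂ) * (z - 1)) := by
    rw [Complex.ofReal_exp, ← Complex.exp_add]; congr 1; push_cast; ring
  rw [h2]; push_cast; norm_num; ring

lemma injOn_exp_neg_two_mul : InjOn (fun v : ℝ => exp (-(2 * v))) (Ioi 0) := by
  intro a _ b _ h
  have := exp_injective h
  linarith

lemma integrableOn_beta {z : ℂ} (hz : 0 < z.re) {ε : ℝ} (hε : 0 < ε) :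
    IntegrableOn (fun v : ℝ => Complex.exp (-(2 * z * v)) *
      ((2 * (1 - exp (-(2 * v))) ^ (ε - 1) : ℝ) : ℂ)) (Ioi 0) := by
  have h := Complex.betaIntegral_convergent hz (v := (ε : ℂ)) (by simpa using hε)
  rw [intervalIntegrable_iff_integrableOn_Ioo_of_le zero_le_one, ← image_exp_neg_two_mul,
    integrableOn_image_iff_integrableOn_abs_deriv_smul measurableSet_Ioi
      (fun v _ => (hasDerivAt_exp_neg_two_mul v).hasDerivWithinAt) injOn_exp_neg_two_mul] at h
  exact h.congr_fun (fun v hv => abs_deriv_smul_beta hv) measurableSet_Ioi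

lemma betaIntegral_eq_integral_exp (z : ℂ) (ε : ℝ) :
    Complex.betaIntegral z ε = ∫ v in Ioi (0 : ℝ), Complex.exp (-(2 * z * v)) *
      ((2 * (1 - exp (-(2 * v))) ^ (ε - 1) : ℝ) : ℂ) := by
  rw [Complex.betaIntegral, intervalIntegral.integral_of_le zero_le_one,
    integral_Ioc_eq_integral_Ioo, ← image_exp_neg_two_mul,
    integral_image_eq_integral_abs_deriv_smul measurableSet_Ioi
      (fun v _ => (hasDerivAt_exp_neg_two_mul v).hasDerivWithinAt) injOn_exp_neg_two_mul]
  exact setIntegral_congr_fun measurableSet_Ioi (fun v hv => abs_deriv_smul_beta hv)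

lemma two_div_one_sub_exp_le {v : ℝ} (hv : 0 < v) :
    2 / (1 - exp (-(2 * v))) ≤ (1 + 2 * v) / v := by
  rw [div_le_div_iff₀ (one_sub_exp_pos hv) hv]
  have h : (1 + 2 * v) * exp (-(2 * v)) ≤ 1 := by
    have h1 := add_one_le_exp (2 * v)
    have h2 : exp (2 * v) * exp (-(2 * v)) = 1 := by rw [← exp_add]; simp
    nlinarith [exp_pos (-(2 * v))]
  linarith

lemma norm_exp_sub_exp_le {m v : ℝ} (hv : 0 ≤ v) {z w : ℂ} (hz : m ≤ z.re) (hw : m ≤ w.re) :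
    ‖Complex.exp (-(2 * w * v)) - Complex.exp (-(2 * z * v))‖ ≤
      2 * v * exp (-(2 * m * v)) * ‖w - z‖ := by
  have hs : Convex ℝ {u : ℂ | m ≤ u.re} := convex_halfSpace_re_ge m
  refine hs.norm_image_sub_le_of_norm_hasDerivWithin_le
    (f := fun u : ℂ => Complex.exp (-(2 * u * v)))
    (f' := fun u : ℂ => Complex.exp (-(2 * u * v)) * (-(2 * v))) (fun u _ => ?_) (fun u hu => ?_)
    hz hw
  · have := (((hasDerivAt_id u).const_mul (2 : ℂ)).mul_const (v : ℂ)).neg.cexp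
    simpa using this.hasDerivWithinAt
  · rw [norm_mul, Complex.norm_exp, norm_neg, norm_mul, Complex.norm_real, norm_of_nonneg hv]
    have : (-(2 * u * v)).re ≤ -(2 * m * v) := by
      have hu' : m ≤ u.re := hu
      simp; nlinarith
    have h2 := exp_le_exp.2 this
    simp only [Complex.norm_ofNat]
    nlinarith [exp_pos (-(2 * u * v)).re]

/-- The difference of exponentials vanishes to first order at `v = 0` and cancels the pole of the
other factor. The decay rate comes from a half-plane `Re ≥ m` containing both `z` and the point `1`,
hence `m ≤ 1`. -/
lemma norm_gaussKernel_le {m v : ℝ} (hm : m ≤ 1) (hv : 0 < v) {z : ℂ} (hz : m ≤ z.re) :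
    ‖gaussKernel z v‖ ≤ 2 * ‖1 - z‖ * ((1 + 2 * v) * exp (-(2 * m * v))) := by
  rw [gaussKernel, norm_mul, Complex.norm_real,
    norm_of_nonneg (div_nonneg zero_le_two (one_sub_exp_pos hv).le)]
  have h1 := norm_exp_sub_exp_le hv.le hz (w := 1) (by simpa using hm)
  rw [mul_one] at h1
  refine (mul_le_mul h1 (two_div_one_sub_exp_le hv)
    (div_nonneg zero_le_two (one_sub_exp_pos hv).le) (by positivity)).trans (le_of_eq ?_)
  field_simp

lemma integrableOn_one_add_mul_exp {m : ℝ} (hm : 0 < m) :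
    IntegrableOn (fun v : ℝ => (1 + 2 * v) * exp (-(2 * m * v))) (Ioi 0) := by
  have h1 := integrableOn_rpow_mul_exp_neg_mul_rpow (p := 1) (s := 0) (b := 2 * m)
    (by norm_num) one_pos (by positivity)
  have h2 := integrableOn_rpow_mul_exp_neg_mul_rpow (p := 1) (s := 1) (b := 2 * m)
    (by norm_num) one_pos (by positivity)
  refine (h1.add (h2.const_mul 2)).congr_fun (fun v hv => ?_) measurableSet_Ioi
  simp; ring

lemma continuousOn_gaussKernel (z : ℂ) : ContinuousOn (gaussKernel z) (Ioi 0) := by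
  unfold gaussKernel
  refine ContinuousOn.mul (by fun_prop) (Complex.continuous_ofReal.comp_continuousOn ?_)
  exact ContinuousOn.div (by fun_prop) (by fun_prop) (fun v hv => (one_sub_exp_pos hv).ne')

lemma integrableOn_gaussKernel {z : ℂ} (hz : 0 < z.re) : IntegrableOn (gaussKernel z) (Ioi 0) := by
  have hm : 0 < min 1 z.re := lt_min one_pos hz
  refine Integrable.mono' ((integrableOn_one_add_mul_exp hm).const_mul (2 * ‖1 - z‖))
    ((continuousOn_gaussKernel z).aestronglyMeasurable measurableSet_Ioi) ?_
  filter_upwards [ae_restrict_mem measurableSet_Ioi] with v hv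
  exact norm_gaussKernel_le (min_le_left _ _) hv (min_le_right _ _)

lemma betaIntegral_one_sub_betaIntegral {z : ℂ} (hz : 0 < z.re) {ε : ℝ} (hε : 0 < ε) :
    Complex.betaIntegral 1 ε - Complex.betaIntegral z ε =
      ∫ v in Ioi (0 : ℝ), gaussKernel z v * (((1 - exp (-(2 * v))) ^ ε : ℝ) : ℂ) := by
  rw [betaIntegral_eq_integral_exp, betaIntegral_eq_integral_exp,
    ← integral_sub (integrableOn_beta (by simp) hε) (integrableOn_beta hz hε)]
  refine setIntegral_congr_fun measurableSet_Ioi (fun v hv => ?_)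
  have h := one_sub_exp_pos hv
  simp only [gaussKernel]
  rw [rpow_sub_one h.ne']
  push_cast
  rw [mul_one]
  ring

lemma tendsto_integral_gaussKernel {z : ℂ} (hz : 0 < z.re) :
    Tendsto (fun ε : ℝ => ∫ v in Ioi (0 : ℝ),
      gaussKernel z v * (((1 - exp (-(2 * v))) ^ ε : ℝ) : ℂ)) (𝓝[>] 0)
      (𝓝 (∫ v in Ioi (0 : ℝ), gaussKernel z v)) := by
  refine tendsto_integral_filter_of_dominated_convergence (fun v => ‖gaussKernel z v‖) ?_ ?_
    (integrableOn_gaussKernel hz).norm ?_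
  · refine Eventually.of_forall fun ε => ?_
    refine ((continuousOn_gaussKernel z).mul (Complex.continuous_ofReal.comp_continuousOn
      ?_)).aestronglyMeasurable measurableSet_Ioi
    exact ContinuousOn.rpow_const (by fun_prop) (fun v hv => Or.inl (one_sub_exp_pos hv).ne')
  · filter_upwards [self_mem_nhdsWithin] with ε hε
    filter_upwards [ae_restrict_mem measurableSet_Ioi] with v hv
    have h := one_sub_exp_pos hv
    rw [norm_mul, Complex.norm_real, norm_of_nonneg (rpow_nonneg h.le _)]
    refine mul_le_of_le_one_right (norm_nonneg _) (rpow_le_one h.le ?_ (le_of_lt hε))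
    linarith [exp_pos (-(2 * v))]
  · filter_upwards [ae_restrict_mem measurableSet_Ioi] with v hv
    have h := one_sub_exp_pos hv
    have h1 : Tendsto (fun ε : ℝ => (1 - exp (-(2 * v))) ^ ε) (𝓝[>] 0) (𝓝 1) := by
      have := ((continuous_const_rpow h.ne').tendsto (0 : ℝ)).mono_left
        (nhdsWithin_le_nhds (s := Ioi 0))
      simpa using this
    have h2 := ((Complex.continuous_ofReal.tendsto 1).comp h1).const_mul (gaussKernel z v)
    simpa using h2

lemma ne_neg_natCast_of_re_pos {z : ℂ} (hz : 0 < z.re) : ∀ m : ℕ, z ≠ -m := by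
  rintro m rfl
  simp at hz
  linarith [Nat.cast_nonneg (α := ℝ) m]

lemma hasDerivAt_Gamma_digamma {z : ℂ} (hz : 0 < z.re) :
    HasDerivAt Complex.Gamma (Complex.Gamma z * Complex.digamma z) z := by
  convert! (Complex.differentiableAt_Gamma z (ne_neg_natCast_of_re_pos hz)).hasDerivAt using 1
  rw [Complex.digamma_def, logDeriv_apply]
  field_simp [Complex.Gamma_ne_zero_of_re_pos hz]

/-- Here `B(w, ε) = Γ(ε) Γ(w) / Γ(w + ε)` and `ε Γ(ε) → 1`, while `Γ(w) / Γ(w + ε)` has value `1`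
and derivative `-ψ(w)` at `ε = 0`. In the difference the values cancel and the derivatives leave
`ψ(z) - ψ(1)`, with `ψ(1) = -γ`. -/
lemma tendsto_betaIntegral_sub {z : ℂ} (hz : 0 < z.re) :
    Tendsto (fun ε : ℝ => Complex.betaIntegral 1 ε - Complex.betaIntegral z ε) (𝓝[>] 0)
      (𝓝 (Complex.digamma z + eulerMascheroniConstant)) := by
  have hd : ∀ w : ℂ, 0 < w.re → HasDerivAt
      (fun ε : ℂ => Complex.Gamma w * (Complex.Gamma (w + ε))⁻¹) (-Complex.digamma w) 0 := by
    intro w hw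
    have hne := Complex.Gamma_ne_zero_of_re_pos hw
    have h1 : HasDerivAt (fun ε : ℂ => Complex.Gamma (w + ε))
        (Complex.Gamma w * Complex.digamma w) 0 := by
      have h0 : HasDerivAt Complex.Gamma (Complex.Gamma w * Complex.digamma w) (w + 0) := by
        simpa using hasDerivAt_Gamma_digamma hw
      exact h0.comp_const_add w 0
    have h2 := (h1.inv (by simpa using hne)).const_mul (Complex.Gamma w)
    convert! h2 using 1
    simp only [add_zero]
    field_simp
  have hD := (hd 1 (by simp)).sub (hd z hz)
  have hslope := hD.tendsto_slope_zero
  have hreal : Tendsto (fun ε : ℝ => (ε : ℂ)) (𝓝[>] 0) (𝓝[≠] 0) := by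
    refine tendsto_nhdsWithin_iff.2 ⟨?_, ?_⟩
    · have := (Complex.continuous_ofReal.tendsto 0).mono_left (nhdsWithin_le_nhds (s := Ioi 0))
      simpa using this
    · filter_upwards [self_mem_nhdsWithin] with ε hε
      simpa using (ne_of_gt hε : ε ≠ 0)
  have hlim := Complex.tendsto_self_mul_Gamma_nhds_zero.mul hslope
  have := hlim.comp hreal
  rw [Complex.digamma_one, one_mul, neg_neg, sub_neg_eq_add, add_comm] at this
  refine this.congr' ?_
  filter_upwards [self_mem_nhdsWithin] with ε hε
  have hε0 : (ε : ℂ) ≠ 0 := by simpa using (ne_of_gt hε : ε ≠ 0)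
  have hεre : 0 < (ε : ℂ).re := by simpa using hε
  have key : ∀ w : ℂ, 0 < w.re → Complex.betaIntegral w ε =
      Complex.Gamma ε * (Complex.Gamma w * (Complex.Gamma (w + ε))⁻¹) := by
    intro w hw
    have h := Complex.Gamma_mul_Gamma_eq_betaIntegral hw hεre
    have hne : Complex.Gamma (w + ε) ≠ 0 :=
      Complex.Gamma_ne_zero_of_re_pos (by rw [Complex.add_re]; positivity)
    field_simp
    rw [mul_comm (Complex.Gamma ε), h, mul_comm]
  rw [key 1 (by simp), key z hz]
  have hz0 := Complex.Gamma_ne_zero_of_re_pos hz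
  simp only [Function.comp, smul_eq_mul, Pi.sub_apply, zero_add, add_zero, mul_inv_cancel₀ hz0,
    Complex.Gamma_one]
  field_simp
  simp

/-- Gauss' integral representation of the digamma function. -/
theorem digamma_add_eulerMascheroniConstant {z : ℂ} (hz : 0 < z.re) :
    Complex.digamma z + eulerMascheroniConstant = ∫ v in Ioi (0 : ℝ), gaussKernel z v := by
  refine tendsto_nhds_unique (tendsto_betaIntegral_sub hz) ?_
  refine (tendsto_integral_gaussKernel hz).congr' ?_
  filter_upwards [self_mem_nhdsWithin] with ε hε
  exact (betaIntegral_one_sub_betaIntegral hz hε).symm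

/-! ### Reduction of `Psi` to the digamma function on the line `Re = 1/4` -/

lemma digamma_add_digamma_add_half {w : ℂ} (hw : 0 < w.re) :
    Complex.digamma w + Complex.digamma (w + 1 / 2) =
      2 * Complex.digamma (2 * w) - 2 * Real.log 2 := by
  have hw1 : 0 < (w + 1 / 2).re := by simp; linarith
  have hw2 : 0 < (2 * w).re := by simpa using hw
  have h1 := (hasDerivAt_Gamma_digamma hw).mul
    (HasDerivAt.comp_add_const w (1 / 2) (hasDerivAt_Gamma_digamma hw1))
  have h2 : HasDerivAt (fun s : ℂ => Complex.Gamma (2 * s))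
      (Complex.Gamma (2 * w) * Complex.digamma (2 * w) * 2) w := by
    have := (hasDerivAt_Gamma_digamma hw2).comp w ((hasDerivAt_id w).const_mul 2)
    simpa [Function.comp_def] using this
  have h3 : HasDerivAt (fun s : ℂ => (2 : ℂ) ^ (1 - 2 * s))
      ((2 : ℂ) ^ (1 - 2 * w) * Complex.log 2 * (-2)) w := by
    have := (((hasDerivAt_id w).const_mul (2 : ℂ)).const_sub 1).const_cpow
      (c := 2) (Or.inl two_ne_zero)
    simpa using this
  have h4 := (h2.mul h3).mul_const ((√π : ℝ) : ℂ)
  have heq : (Complex.Gamma * fun s => Complex.Gamma (s + 1 / 2)) =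
      fun s => ((fun s : ℂ => Complex.Gamma (2 * s)) * fun s : ℂ => (2 : ℂ) ^ (1 - 2 * s)) s *
        ((√π : ℝ) : ℂ) := by
    funext s
    exact Complex.Gamma_mul_Gamma_add_half s
  rw [heq] at h1
  have h5 := h1.unique h4
  have h6 := Complex.Gamma_mul_Gamma_add_half w
  have hne1 := Complex.Gamma_ne_zero_of_re_pos hw
  have hne2 := Complex.Gamma_ne_zero_of_re_pos hw1
  have hlog : Complex.log 2 = ((Real.log 2 : ℝ) : ℂ) := by
    rw [Complex.ofReal_log zero_le_two]; simp
  rw [hlog] at h5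
  refine mul_left_cancel₀ (mul_ne_zero hne1 hne2) ?_
  calc _ = Complex.Gamma w * Complex.digamma w * Complex.Gamma (w + 1 / 2) + Complex.Gamma w *
        (Complex.Gamma (w + 1 / 2) * Complex.digamma (w + 1 / 2)) := by ring
    _ = _ := h5
    _ = (Complex.Gamma (2 * w) * 2 ^ (1 - 2 * w) * ((√π : ℝ) : ℂ)) *
        (2 * Complex.digamma (2 * w) - 2 * Real.log 2) := by ring
    _ = _ := by rw [h6]

/-- Logarithmic derivative of the reflection formula; the duplication lemma above arises in the same
way. -/
lemma digamma_sub_digamma_one_sub {w : ℂ} (hw : 0 < w.re) (hw' : w.re < 1) :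
    Complex.digamma (1 - w) - Complex.digamma w =
      π * (Complex.cos (π * w) / Complex.sin (π * w)) := by
  have hw1 : 0 < (1 - w).re := by simpa using hw'
  have h1 := (hasDerivAt_Gamma_digamma hw).mul
    (HasDerivAt.comp_const_sub 1 w (hasDerivAt_Gamma_digamma hw1))
  have hne1 := Complex.Gamma_ne_zero_of_re_pos hw
  have hne2 := Complex.Gamma_ne_zero_of_re_pos hw1
  have h6 := Complex.Gamma_mul_Gamma_one_sub w
  have hsin : Complex.sin (π * w) ≠ 0 := by
    intro h
    rw [h, div_zero] at h6
    exact mul_ne_zero hne1 hne2 h6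
  have h2 : HasDerivAt (fun s : ℂ => Complex.sin (π * s)) (Complex.cos (π * w) * π) w := by
    have := ((hasDerivAt_id w).const_mul (π : ℂ)).csin
    simpa using this
  have h4 := (h2.inv hsin).const_mul (π : ℂ)
  have heq : (Complex.Gamma * fun s => Complex.Gamma (1 - s)) =
      fun s => π * ((fun s : ℂ => Complex.sin (π * s))⁻¹ s) := by
    funext s
    simpa [div_eq_mul_inv] using Complex.Gamma_mul_Gamma_one_sub s
  rw [heq] at h1
  have h5 := h1.unique h4
  refine mul_left_cancel₀ (mul_ne_zero hne1 hne2) ?_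
  calc _ = -(Complex.Gamma w * Complex.digamma w * Complex.Gamma (1 - w) + Complex.Gamma w *
        -(Complex.Gamma (1 - w) * Complex.digamma (1 - w))) := by ring
    _ = _ := by rw [h5, h6]; field_simp

lemma digamma_conj (z : ℂ) :
    Complex.digamma (starRingEnd ℂ z) = starRingEnd ℂ (Complex.digamma z) := by
  have : Complex.Gamma = starRingEnd ℂ ∘ Complex.Gamma ∘ starRingEnd ℂ := by
    funext s; simp [Complex.Gamma_conj]
  have h : deriv Complex.Gamma (starRingEnd ℂ z) = starRingEnd ℂ (deriv Complex.Gamma z) := by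
    conv_lhs => rw [this, deriv_conj_conj]
    simp
  rw [Complex.digamma_def, logDeriv_apply, logDeriv_apply, h, Complex.Gamma_conj, map_div₀]

/-- Used with `b = πt/2`, this accounts for the hyperbolic cosine in `Psi`. -/
lemma re_cot_quarter (b : ℝ) :
    (Complex.cos (π / 4 + b * Complex.I) / Complex.sin (π / 4 + b * Complex.I)).re =
      1 / cosh (2 * b) := by
  have e4 : ((π : ℂ) / 4) = ((π / 4 : ℝ) : ℂ) := by push_cast; ring
  rw [Complex.cos_add_mul_I, Complex.sin_add_mul_I, e4, ← Complex.ofReal_cos, ← Complex.ofReal_sin,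
    cos_pi_div_four, sin_pi_div_four, ← Complex.ofReal_cosh, ← Complex.ofReal_sinh]
  have h2 : ((√2 / 2 : ℝ) : ℂ) ≠ 0 := by
    rw [Complex.ofReal_ne_zero]; positivity
  rw [show ((√2 / 2 : ℝ) : ℂ) * (cosh b : ℝ) - ((√2 / 2 : ℝ) : ℂ) * (sinh b : ℝ) * Complex.I =
    ((√2 / 2 : ℝ) : ℂ) * ((cosh b : ℝ) - (sinh b : ℝ) * Complex.I) by ring,
    show ((√2 / 2 : ℝ) : ℂ) * (cosh b : ℝ) + ((√2 / 2 : ℝ) : ℂ) * (sinh b : ℝ) * Complex.I =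
    ((√2 / 2 : ℝ) : ℂ) * ((cosh b : ℝ) + (sinh b : ℝ) * Complex.I) by ring,
    mul_div_mul_left _ _ h2, Complex.div_re, cosh_two_mul]
  have h3 := cosh_sq b
  have h4 : cosh b ^ 2 + sinh b ^ 2 ≠ 0 := by positivity
  simp only [Complex.normSq_apply, Complex.sub_re, Complex.add_re, Complex.sub_im, Complex.add_im,
    Complex.mul_re, Complex.mul_im, Complex.ofReal_re, Complex.ofReal_im, Complex.I_re,
    Complex.I_im]
  simp only [mul_zero, mul_one, sub_zero, add_zero, zero_add, zero_sub]
  rw [← add_div, ← pow_two, ← pow_two]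
  congr 1
  linarith

lemma Psi_eq_log_pi_sub (t : ℝ) :
    Psi t = Real.log π - (Complex.digamma (1 / 4 + Complex.I * (t / 2))).re := by
  set w : ℂ := 1 / 4 + Complex.I * (t / 2) with hw
  have hre : w.re = 1 / 4 := by simp [hw]
  have h1 := digamma_add_digamma_add_half (w := w) (by rw [hre]; norm_num)
  have h2 := digamma_sub_digamma_one_sub (w := w) (by rw [hre]; norm_num) (by rw [hre]; norm_num)
  -- On the line `Re w = 1/4` the points `w + 1/2` and `1 - w` are conjugate, so duplication gives
  -- the sum and reflection the difference of the same two real parts.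
  have h3 : w + 1 / 2 = starRingEnd ℂ (1 - w) := by
    apply Complex.ext
    · rw [Complex.conj_re, Complex.add_re, Complex.sub_re, hre]; norm_num
    · rw [Complex.conj_im, Complex.add_im, Complex.sub_im]; simp
  have h4 : (2 * w) = 1 / 2 + Complex.I * t := by rw [hw]; ring
  have h5 : π * w = π / 4 + ((π * t / 2 : ℝ) : ℂ) * Complex.I := by
    rw [hw]; push_cast; ring
  rw [h3, digamma_conj, h4] at h1
  have h6 : 2 * Complex.digamma (1 / 2 + Complex.I * t) - 2 * Real.log 2 =
      ((2 : ℝ) : ℂ) * Complex.digamma (1 / 2 + Complex.I * t) - ((2 * Real.log 2 : ℝ) : ℂ) := by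
    push_cast; rfl
  rw [h6] at h1
  have h1' := congrArg Complex.re h1
  have h2' := congrArg Complex.re h2
  rw [h5, Complex.re_ofReal_mul, re_cot_quarter, show 2 * (π * t / 2) = π * t by ring] at h2'
  simp only [Complex.add_re, Complex.sub_re, Complex.conj_re, Complex.re_ofReal_mul,
    Complex.ofReal_re] at h1' h2'
  rw [Psi, Real.log_mul two_ne_zero pi_ne_zero]
  have h7 : π / (2 * cosh (π * t)) = π * (1 / cosh (π * t)) / 2 := by field_simp
  rw [h7]
  linarith

/-! ### `Psi` as a cosine integral and `Phi` as a Gaussian integral -/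

/-- The function `2 e^{-v/2} / (1 - e^{-2v})`, the cosine transform of the oscillating part
of `Psi`. -/
def weight (v : ℝ) : ℝ := 2 * exp (-(v / 2)) / (1 - exp (-(2 * v)))

/-- The function `2 / (e^{2v} - 1)`, which regularizes `weight` at the origin. -/
def planck (v : ℝ) : ℝ := 2 * exp (-(2 * v)) / (1 - exp (-(2 * v)))

@[fun_prop]
lemma measurable_weight : Measurable weight := by unfold weight; fun_prop

@[fun_prop]
lemma measurable_planck : Measurable planck := by unfold planck; fun_prop

lemma gaussKernel_re (t v : ℝ) :
    (gaussKernel (1 / 4 + Complex.I * (t / 2)) v).re =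
      -(cos (t * v) * weight v - planck v) := by
  rw [gaussKernel, Complex.re_mul_ofReal, Complex.sub_re]
  have h1 : (Complex.exp (-(2 * v))).re = exp (-(2 * v)) := by
    rw [show (-(2 * v) : ℂ) = ((-(2 * v) : ℝ) : ℂ) by push_cast; rfl, ← Complex.ofReal_exp,
      Complex.ofReal_re]
  have h2 : (Complex.exp (-(2 * (1 / 4 + Complex.I * (t / 2)) * v))).re =
      exp (-(v / 2)) * cos (t * v) := by
    rw [show (-(2 * (1 / 4 + Complex.I * (t / 2)) * v) : ℂ) =
      ((-(v / 2) : ℝ) : ℂ) + ((-(t * v) : ℝ) : ℂ) * Complex.I by push_cast; ring,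
      Complex.exp_re]
    simp
  rw [h1, h2, weight, planck]
  ring

lemma Psi_eq_integral (t : ℝ) :
    Psi t = Real.log π + eulerMascheroniConstant +
      ∫ v in Ioi (0 : ℝ), (cos (t * v) * weight v - planck v) := by
  have hre : 0 < (1 / 4 + Complex.I * ((t : ℂ) / 2)).re := by simp
  have h := congrArg Complex.re (digamma_add_eulerMascheroniConstant hre)
  have h2 : (∫ v in Ioi (0 : ℝ), gaussKernel (1 / 4 + Complex.I * ((t : ℂ) / 2)) v).re =
      ∫ v in Ioi (0 : ℝ), (gaussKernel (1 / 4 + Complex.I * ((t : ℂ) / 2)) v).re :=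
    (integral_re (integrableOn_gaussKernel hre)).symm
  rw [h2] at h
  simp only [gaussKernel_re] at h
  rw [integral_neg, Complex.add_re, Complex.ofReal_re] at h
  rw [Psi_eq_log_pi_sub]
  linarith

lemma abs_cos_mul_weight_sub_planck_le (t : ℝ) {v : ℝ} (hv : 0 < v) :
    |cos (t * v) * weight v - planck v| ≤
      (3 / 2 + |t|) * ((1 + 2 * v) * exp (-(2 * (1 / 4) * v))) := by
  have h := norm_gaussKernel_le (m := 1 / 4) (z := 1 / 4 + Complex.I * ((t : ℂ) / 2))
    (by norm_num) hv (by simp)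
  have h2 := Complex.abs_re_le_norm (gaussKernel (1 / 4 + Complex.I * ((t : ℂ) / 2)) v)
  rw [gaussKernel_re, abs_neg] at h2
  refine h2.trans (h.trans ?_)
  refine mul_le_mul_of_nonneg_right ?_ (by positivity)
  have h3 : ‖1 - (1 / 4 + Complex.I * ((t : ℂ) / 2))‖ ≤ 3 / 4 + |t| / 2 := by
    rw [show 1 - (1 / 4 + Complex.I * ((t : ℂ) / 2)) = 3 / 4 - Complex.I * ((t : ℂ) / 2) by ring]
    refine (norm_sub_le _ _).trans (le_of_eq ?_)
    simp
  linarith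

/-- The kernel bound grows only linearly in `t`, so the Gaussian dominates and Fubini applies. The
marginals also supply the integrability of `exp (-x t²) Psi t` and of the inner integrand in `v`. -/
lemma integrable_gaussian_mul_kernel {x : ℝ} (hx : 0 < x) :
    Integrable (fun p : ℝ × ℝ => exp (-x * p.1 ^ 2) *
      (cos (p.1 * p.2) * weight p.2 - planck p.2))
      ((volume.restrict (Ioi 0)).prod (volume.restrict (Ioi 0))) := by
  have h1 : IntegrableOn (fun t : ℝ => exp (-x * t ^ 2) * (3 / 2 + t)) (Ioi 0) := by
    have ha := (integrable_exp_neg_mul_sq hx).integrableOn (s := Ioi 0)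
    have hb := (integrable_mul_exp_neg_mul_sq hx).integrableOn (s := Ioi 0)
    refine ((ha.const_mul (3 / 2)).add hb).congr (Eventually.of_forall fun t => ?_)
    simp only [Pi.add_apply]; ring
  have h2 := integrableOn_one_add_mul_exp (m := 1 / 4) (by norm_num)
  refine (h1.mul_prod h2).mono' ?_ ?_
  · exact Measurable.aestronglyMeasurable (by fun_prop)
  · rw [Measure.prod_restrict]
    filter_upwards [ae_restrict_mem (measurableSet_Ioi.prod measurableSet_Ioi)] with p hp
    have h := abs_cos_mul_weight_sub_planck_le p.1 hp.2
    rw [abs_of_pos (show 0 < p.1 from hp.1)] at h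
    rw [norm_mul, norm_of_nonneg (exp_pos _).le, mul_assoc]
    exact mul_le_mul_of_nonneg_left h (exp_pos _).le

lemma integrableOn_gaussian_mul_Psi {x : ℝ} (hx : 0 < x) :
    IntegrableOn (fun t : ℝ => exp (-x * t ^ 2) * Psi t) (Ioi 0) := by
  have h1 := ((integrable_exp_neg_mul_sq hx).integrableOn (s := Ioi 0)).mul_const
    (Real.log π + eulerMascheroniConstant)
  have h2 := (integrable_gaussian_mul_kernel hx).integral_prod_left
  refine (h1.add h2).congr (Eventually.of_forall fun t => ?_)
  simp only [Pi.add_apply, integral_const_mul, Psi_eq_integral]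
  ring

lemma integral_gaussian_mul_cos {x : ℝ} (hx : 0 < x) (v : ℝ) :
    ∫ t in Ioi (0 : ℝ), exp (-x * t ^ 2) * cos (t * v) =
      √(π / x) / 2 * exp (-(v ^ 2 / (4 * x))) := by
  have h := fourierIntegral_gaussian (b := x) (by simpa using hx) v
  have hint : Integrable (fun t : ℝ => Complex.exp (Complex.I * v * t) *
      Complex.exp (-x * t ^ 2)) := by
    have := integrable_cexp_quadratic (b := x) (by simpa using hx) (Complex.I * v) 0
    refine this.congr (Eventually.of_forall fun t => ?_)
    simp only [← Complex.exp_add]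
    congr 1; ring
  -- Writing the even integrand in terms of `|t|` lets `integral_comp_abs` pass from the whole line
  -- to twice the half-line.
  have hre : ∀ t : ℝ, (Complex.exp (Complex.I * v * t) * Complex.exp (-x * t ^ 2)).re =
      exp (-x * |t| ^ 2) * cos (|t| * v) := by
    intro t
    rw [sq_abs, show cos (|t| * v) = cos (t * v) by
      rcases abs_choice t with h | h <;> rw [h]
      rw [neg_mul, cos_neg]]
    rw [← Complex.exp_add, show Complex.I * v * t + -x * t ^ 2 =
      ((-x * t ^ 2 : ℝ) : ℂ) + ((t * v : ℝ) : ℂ) * Complex.I by push_cast; ring, Complex.exp_re]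
    simp only [Complex.add_re, Complex.add_im, Complex.mul_re, Complex.mul_im, Complex.ofReal_re,
      Complex.ofReal_im, Complex.I_re, Complex.I_im, mul_zero, mul_one, zero_add, sub_zero,
      add_zero]
  have h1 := congrArg Complex.re h
  have h2 : (∫ t : ℝ, Complex.exp (Complex.I * v * t) * Complex.exp (-x * t ^ 2)).re =
      ∫ t : ℝ, (Complex.exp (Complex.I * v * t) * Complex.exp (-x * t ^ 2)).re :=
    (integral_re hint).symm
  rw [h2] at h1
  simp only [hre] at h1
  rw [integral_comp_abs (f := fun t => exp (-x * t ^ 2) * cos (t * v))] at h1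
  have h3 : ((π / x : ℂ) ^ (1 / 2 : ℂ) * Complex.exp (-v ^ 2 / (4 * x))).re =
      √(π / x) * exp (-(v ^ 2 / (4 * x))) := by
    rw [sqrt_eq_rpow, show (π / x : ℂ) ^ (1 / 2 : ℂ) * Complex.exp (-v ^ 2 / (4 * x)) =
      (((π / x) ^ (1 / 2 : ℝ) * exp (-(v ^ 2 / (4 * x))) : ℝ) : ℂ) by
        rw [Complex.ofReal_mul, Complex.ofReal_exp, Complex.ofReal_cpow (by positivity)]
        push_cast
        rw [neg_div], Complex.ofReal_re]
  rw [h3] at h1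
  linarith

lemma integral_gaussian_mul_kernel {x : ℝ} (hx : 0 < x) (v : ℝ) :
    ∫ t in Ioi (0 : ℝ), exp (-x * t ^ 2) *
      (cos (t * v) * weight v - planck v) =
      √(π / x) / 2 * (exp (-(v ^ 2 / (4 * x))) * weight v - planck v) := by
  have hg := (integrable_exp_neg_mul_sq hx).integrableOn (s := Ioi 0)
  have hc : IntegrableOn (fun t : ℝ => exp (-x * t ^ 2) * cos (t * v)) (Ioi 0) := by
    refine hg.mono' (Measurable.aestronglyMeasurable (by fun_prop))
      (Eventually.of_forall fun t => ?_)
    rw [norm_mul, norm_of_nonneg (exp_pos _).le]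
    exact mul_le_of_le_one_right (exp_pos _).le (abs_cos_le_one _)
  have heq : ∀ t : ℝ, exp (-x * t ^ 2) * (cos (t * v) * weight v - planck v) =
      exp (-x * t ^ 2) * cos (t * v) * weight v - exp (-x * t ^ 2) * planck v := by
    intro t; ring
  simp only [heq]
  rw [integral_sub (hc.mul_const _) (hg.mul_const _), integral_mul_const, integral_mul_const,
    integral_gaussian_mul_cos hx, integral_gaussian_Ioi]
  ring

lemma Phi_eq_integral {x : ℝ} (hx : 0 < x) :
    Phi x = 1 / (4 * √(π * x)) * (Real.log π + eulerMascheroniConstant +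
      ∫ v in Ioi (0 : ℝ), (exp (-(v ^ 2 / (4 * x))) * weight v - planck v)) := by
  have h1 := ((integrable_exp_neg_mul_sq hx).integrableOn (s := Ioi 0)).mul_const
    (Real.log π + eulerMascheroniConstant)
  have h2 := (integrable_gaussian_mul_kernel hx).integral_prod_left
  have hsplit : ∫ t in Ioi (0 : ℝ), exp (-x * t ^ 2) * Psi t =
      (∫ t in Ioi (0 : ℝ), exp (-x * t ^ 2) * (Real.log π + eulerMascheroniConstant)) +
      ∫ t in Ioi (0 : ℝ), ∫ v in Ioi (0 : ℝ), exp (-x * t ^ 2) *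
        (cos (t * v) * weight v - planck v) := by
    rw [← integral_add h1 h2]
    refine integral_congr_ae (Eventually.of_forall fun t => ?_)
    simp only [integral_const_mul, Psi_eq_integral]
    ring
  rw [Phi, hsplit, integral_mul_const, integral_gaussian_Ioi,
    integral_integral_swap (integrable_gaussian_mul_kernel hx)]
  simp only [integral_gaussian_mul_kernel hx, integral_const_mul]
  rw [sqrt_div pi_pos.le, sqrt_mul pi_pos.le]
  have hs : √π ≠ 0 := by positivity
  have hs' : √x ≠ 0 := by positivity
  have hpi : √π ^ 2 = π := sq_sqrt pi_pos.le
  have hc : 1 / (2 * π) * (√π / √x / 2) = 1 / (4 * (√π * √x)) := by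
    rw [← hpi, sqrt_sq (sqrt_nonneg _)]
    field_simp
    norm_num
  rw [← hc]
  ring

lemma integrableOn_exp_mul_weight_sub_planck {x : ℝ} (hx : 0 < x) :
    IntegrableOn (fun v : ℝ => exp (-(v ^ 2 / (4 * x))) * weight v - planck v) (Ioi 0) := by
  have h := (integrable_gaussian_mul_kernel hx).integral_prod_right
  simp only [integral_gaussian_mul_kernel hx] at h
  have hne : √(π / x) / 2 ≠ 0 := by positivity
  exact (integrable_const_mul_iff (IsUnit.mk0 _ hne) _).1 h

/-! ### Taylor expansion of `weight` at the origin -/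

/-- The coefficient `B_n(3/4) / n!`. -/
def bernoulliCoeff (n : ℕ) : ℝ :=
  (((Polynomial.bernoulli n).eval (3 / 4 : ℚ) : ℚ) : ℝ) / (n.factorial : ℝ)

lemma bernoulliCoeff_zero : bernoulliCoeff 0 = 1 := by simp [bernoulliCoeff]

lemma aeval_bernoulli_eq_bernoulliCoeff (n : ℕ) :
    Polynomial.aeval (3 / 4 : ℝ) ((1 / n.factorial : ℚ) • Polynomial.bernoulli n) =
      bernoulliCoeff n := by
  have h : Polynomial.aeval (3 / 4 : ℝ) (Polynomial.bernoulli n) =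
      (((Polynomial.bernoulli n).eval (3 / 4 : ℚ) : ℚ) : ℝ) := by
    have := Polynomial.aeval_algebraMap_apply ℝ (3 / 4 : ℚ) (Polynomial.bernoulli n)
    simpa using this
  rw [map_smul, h, bernoulliCoeff, Rat.smul_def]
  push_cast
  ring

lemma X_pow_dvd_sub_trunc (n : ℕ) (f : PowerSeries ℝ) :
    (PowerSeries.X : PowerSeries ℝ) ^ n ∣ f - (PowerSeries.trunc n f : PowerSeries ℝ) := by
  rw [PowerSeries.X_pow_dvd_iff]
  intro m hm
  simp [PowerSeries.coeff_trunc, hm]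

lemma X_dvd_exp_sub_one : (PowerSeries.X : PowerSeries ℝ) ∣ PowerSeries.exp ℝ - 1 := by
  rw [PowerSeries.X_dvd_iff]; simp

/-- The exponential generating series of `B_n(3/4)`. -/
def bernoulliSeries : PowerSeries ℝ := PowerSeries.mk bernoulliCoeff

lemma bernoulliSeries_mul :
    bernoulliSeries * (PowerSeries.exp ℝ - 1) =
      PowerSeries.X * PowerSeries.rescale (3 / 4 : ℝ) (PowerSeries.exp ℝ) := by
  have := Polynomial.bernoulli_generating_function (3 / 4 : ℝ)
  simp only [aeval_bernoulli_eq_bernoulliCoeff] at this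
  exact this

/-- A polynomial form of the generating identity, which makes convergence of the Bernoulli series
irrelevant: analytically only Taylor's estimate for `exp` is needed. The exponent is `N + 2`, one
more than the truncation of `bernoulliSeries`, because `e^X - 1` is divisible by `X`. -/
lemma X_pow_dvd_truncated_generating_function (N : ℕ) :
    (Polynomial.X : Polynomial ℝ) ^ (N + 2) ∣
      Polynomial.X * PowerSeries.trunc (N + 2)
        (PowerSeries.rescale (3 / 4 : ℝ) (PowerSeries.exp ℝ)) -
      PowerSeries.trunc (N + 1) bernoulliSeries *
        (PowerSeries.trunc (N + 2) (PowerSeries.exp ℝ) - 1) := by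
  set E := PowerSeries.exp ℝ with hE
  set R := PowerSeries.rescale (3 / 4 : ℝ) E with hR
  set Q := Polynomial.X * PowerSeries.trunc (N + 2) R -
    PowerSeries.trunc (N + 1) bernoulliSeries * (PowerSeries.trunc (N + 2) E - 1) with hQ
  have hcoe : (Q : PowerSeries ℝ) =
      -(PowerSeries.X * (R - (PowerSeries.trunc (N + 2) R : PowerSeries ℝ))) +
      (bernoulliSeries - (PowerSeries.trunc (N + 1) bernoulliSeries : PowerSeries ℝ)) * (E - 1) +
      (PowerSeries.trunc (N + 1) bernoulliSeries : PowerSeries ℝ) *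
        (E - (PowerSeries.trunc (N + 2) E : PowerSeries ℝ)) := by
    have h := bernoulliSeries_mul
    rw [← hE, ← hR] at h
    rw [hQ]
    push_cast
    linear_combination -h
  have hdvd : (PowerSeries.X : PowerSeries ℝ) ^ (N + 2) ∣ (Q : PowerSeries ℝ) := by
    rw [hcoe]
    refine dvd_add (dvd_add ?_ ?_) ?_
    · exact ((X_pow_dvd_sub_trunc (N + 2) R).mul_left _).neg_right
    · rw [pow_succ]
      exact mul_dvd_mul (X_pow_dvd_sub_trunc _ _) X_dvd_exp_sub_one
    · exact (X_pow_dvd_sub_trunc (N + 2) E).mul_left _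
  rw [Polynomial.X_pow_dvd_iff]
  intro d hd
  have := PowerSeries.X_pow_dvd_iff.1 hdvd d hd
  rwa [Polynomial.coeff_coe] at this

open Asymptotics in
lemma isBigO_exp_sub_eval_trunc (c : ℝ) (n : ℕ) :
    (fun y : ℝ => exp (c * y) - (PowerSeries.trunc n
      (PowerSeries.rescale c (PowerSeries.exp ℝ))).eval y) =O[𝓝 0] (fun y => y ^ n) := by
  have h1 : Tendsto (fun y : ℝ => c * y) (𝓝 0) (𝓝 0) := by
    have : Continuous (fun y : ℝ => c * y) := by fun_prop
    simpa using this.tendsto 0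
  have h := (exp_sub_sum_range_isBigO_pow n).comp_tendsto h1
  have h2 : (fun y : ℝ => exp (c * y) - (PowerSeries.trunc n
      (PowerSeries.rescale c (PowerSeries.exp ℝ))).eval y) =
      (fun x => exp x - ∑ i ∈ Finset.range n, x ^ i / (i.factorial : ℝ)) ∘ fun y => c * y := by
    funext y
    simp only [Function.comp]
    rw [← Polynomial.eval₂_id, PowerSeries.eval₂_trunc_eq_sum_range]
    congr 1
    refine Finset.sum_congr rfl fun i _ => ?_
    simp [PowerSeries.coeff_exp, mul_pow]
    ring
  rw [h2]
  refine h.trans ?_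
  refine IsBigO.of_bound (‖c‖ ^ n) (Eventually.of_forall fun y => ?_)
  simp [mul_pow]

open Asymptotics in
lemma isBigO_mul_exp_sub (N : ℕ) :
    (fun y : ℝ => y * exp (3 / 4 * y) - (PowerSeries.trunc (N + 1) bernoulliSeries).eval y *
      (exp y - 1)) =O[𝓝 0] (fun y => y ^ (N + 2)) := by
  obtain ⟨Q, hQ⟩ := X_pow_dvd_truncated_generating_function N
  have h1 := isBigO_exp_sub_eval_trunc (3 / 4) (N + 2)
  have h2 := isBigO_exp_sub_eval_trunc 1 (N + 2)
  simp only [one_mul, PowerSeries.rescale_one, RingHom.id_apply] at h2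
  have hbdd : ∀ P : Polynomial ℝ, (fun y : ℝ => P.eval y) =O[𝓝 0] (fun _ => (1 : ℝ)) := fun P =>
    (P.continuous.tendsto 0).isBigO_one ℝ
  have hX := hbdd Polynomial.X
  have h3 := hX.mul h1
  have h4 := (hbdd (PowerSeries.trunc (N + 1) bernoulliSeries)).mul h2
  have h5 := (hbdd Q).mul (isBigO_refl (fun y : ℝ => y ^ (N + 2)) (𝓝 0))
  simp only [one_mul] at h3 h4 h5
  refine ((h3.sub h4).add h5).congr_left fun y => ?_
  have hy := congrArg (Polynomial.eval y) hQ
  simp only [Polynomial.eval_sub, Polynomial.eval_mul, Polynomial.eval_pow, Polynomial.eval_X,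
    Polynomial.eval_one] at hy
  rw [Polynomial.eval_X]
  linear_combination -hy

/-- The Laurent polynomial `∑_{n ≤ N} B_n(3/4) 2^n v^{n-1} / n!`. -/
def weightPoly (N : ℕ) (v : ℝ) : ℝ :=
  (∑ n ∈ Finset.range (N + 1), bernoulliCoeff n * (2 * v) ^ n) / v

lemma weightPoly_eq_sum {N : ℕ} {v : ℝ} (hv : 0 < v) :
    weightPoly N v = 1 / v + ∑ n ∈ Finset.Icc 1 N, bernoulliCoeff n * 2 ^ n * v ^ (n - 1) := by
  rw [weightPoly, Finset.range_eq_Ico, Finset.sum_eq_sum_Ico_succ_bot (by omega), add_div]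
  congr 1
  · simp [bernoulliCoeff_zero]
  · rw [Finset.sum_div]
    refine Finset.sum_congr rfl fun n hn => ?_
    obtain ⟨k, rfl⟩ : ∃ k, n = k + 1 := ⟨n - 1, by simp at hn; omega⟩
    rw [Nat.add_sub_cancel, mul_pow, pow_succ v]
    field_simp

lemma weight_sub_weightPoly (N : ℕ) {v : ℝ} (hv : 0 < v) :
    weight v - weightPoly N v = (2 * v * exp (3 / 4 * (2 * v)) -
      (PowerSeries.trunc (N + 1) bernoulliSeries).eval (2 * v) * (exp (2 * v) - 1)) /
        (v * (exp (2 * v) - 1)) := by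
  have hp : (PowerSeries.trunc (N + 1) bernoulliSeries).eval (2 * v) =
      ∑ n ∈ Finset.range (N + 1), bernoulliCoeff n * (2 * v) ^ n := by
    rw [← Polynomial.eval₂_id, PowerSeries.eval₂_trunc_eq_sum_range]
    simp [bernoulliSeries]
  have h1 : exp (2 * v) - 1 ≠ 0 := by
    have : 1 < exp (2 * v) := by rw [one_lt_exp_iff]; linarith
    linarith
  have h2 := (one_sub_exp_pos hv).ne'
  have h3 : weight v = 2 * exp (3 / 4 * (2 * v)) / (exp (2 * v) - 1) := by
    have e1 : exp (-(v / 2)) * exp (2 * v) = exp (3 / 4 * (2 * v)) := by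
      rw [← exp_add]; ring_nf
    have e2 : exp (3 / 4 * (2 * v)) * exp (-(2 * v)) = exp (-(v / 2)) := by
      rw [← exp_add]; ring_nf
    rw [weight, div_eq_div_iff h2 h1]
    linear_combination 2 * e1 + 2 * e2
  rw [h3, weightPoly, hp]
  field_simp

lemma weight_nonneg {v : ℝ} (hv : 0 < v) : 0 ≤ weight v :=
  div_nonneg (by positivity) (one_sub_exp_pos hv).le

lemma weight_le {δ v : ℝ} (hδ : 0 < δ) (hv : δ ≤ v) : weight v ≤ weight δ := by
  have h1 := one_sub_exp_pos hδ
  unfold weight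
  have h2 : exp (-(v / 2)) ≤ exp (-(δ / 2)) := exp_le_exp.2 (by linarith)
  have h3 : exp (-(2 * v)) ≤ exp (-(2 * δ)) := exp_le_exp.2 (by linarith)
  gcongr

/-- The bound holds on the whole half-line, so the `v`-integral need not be split. Near `0` it is
the Taylor estimate divided by `v (exp (2v) - 1) ≥ 2v²`. For `v ≥ η` the weight is bounded and every
power `v^(n-1)` with `n ≤ N` is at most a constant times `v^N`. -/
lemma exists_abs_weight_sub_weightPoly_le (N : ℕ) :
    ∃ C, ∀ v : ℝ, 0 < v → |weight v - weightPoly N v| ≤ C * v ^ N := by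
  obtain ⟨C₁, hC₁, hb⟩ := (isBigO_mul_exp_sub N).exists_pos
  obtain ⟨δ, hδ, hball⟩ := Metric.eventually_nhds_iff.1 hb.bound
  have hη : 0 < δ / 4 := by positivity
  set η := δ / 4 with hηdef
  -- The constant for `v ≥ η`, from `weight v ≤ weight η` and `v^n ≤ η^(n-N-1) v^(N+1)`; the factor
  -- `η^N` inside the sum only serves the common denominator.
  set C₂ : ℝ := (weight η + ∑ n ∈ Finset.range (N + 1), |bernoulliCoeff n| * 2 ^ n *
    (η ^ n / η ^ (N + 1)) * η ^ N) / η ^ N with hC₂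
  refine ⟨max (C₁ * 2 ^ N * 2) C₂, fun v hv => ?_⟩
  rcases lt_or_ge v η with hvη | hvη
  · have h := @hball (2 * v) (by rw [dist_zero_right, norm_of_nonneg (by positivity)]; linarith)
    rw [norm_pow, norm_of_nonneg (by positivity : 0 ≤ 2 * v), Real.norm_eq_abs] at h
    rw [weight_sub_weightPoly N hv, abs_div]
    have h1 : 2 * v ≤ exp (2 * v) - 1 := by linarith [add_one_le_exp (2 * v)]
    have h2 : v * (2 * v) ≤ v * (exp (2 * v) - 1) := by gcongr
    rw [abs_of_pos (lt_of_lt_of_le (by positivity) h2)]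
    calc _ ≤ C₁ * (2 * v) ^ (N + 2) / (v * (2 * v)) := by gcongr
      _ = C₁ * 2 ^ N * 2 * v ^ N := by field_simp; ring
      _ ≤ _ := by gcongr; exact le_max_left _ _
  · have hvN : η ^ N ≤ v ^ N := by gcongr
    have h1 : |weight v - weightPoly N v| ≤ weight v + |weightPoly N v| := by
      refine (abs_sub _ _).trans ?_
      rw [abs_of_nonneg (weight_nonneg hv)]
    have h2 : |weightPoly N v| ≤ ∑ n ∈ Finset.range (N + 1), |bernoulliCoeff n| * 2 ^ n *
        (η ^ n / η ^ (N + 1)) * v ^ N := by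
      rw [weightPoly, abs_div, abs_of_pos hv, div_le_iff₀ hv, Finset.sum_mul]
      refine (Finset.abs_sum_le_sum_abs _ _).trans (Finset.sum_le_sum fun n hn => ?_)
      have hn' : n ≤ N + 1 := by have := Finset.mem_range.1 hn; omega
      rw [abs_mul, abs_of_nonneg (by positivity : 0 ≤ (2 * v) ^ n), mul_pow]
      have key : v ^ n ≤ η ^ n / η ^ (N + 1) * v ^ N * v := by
        obtain ⟨k, hk⟩ := Nat.exists_eq_add_of_le hn'
        rw [mul_assoc, ← pow_succ, hk, pow_add, pow_add, div_mul_eq_mul_div,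
          le_div_iff₀ (by positivity)]
        have : η ^ k ≤ v ^ k := by gcongr
        have h3 : 0 ≤ v ^ n * η ^ n := by positivity
        nlinarith
      calc _ = |bernoulliCoeff n| * 2 ^ n * v ^ n := by ring
        _ ≤ |bernoulliCoeff n| * 2 ^ n * (η ^ n / η ^ (N + 1) * v ^ N * v) := by gcongr
        _ = _ := by ring
    have h3 : weight v ≤ weight η / η ^ N * v ^ N := by
      refine (weight_le hη hvη).trans ?_
      rw [div_mul_eq_mul_div, le_div_iff₀ (by positivity)]
      exact mul_le_mul_of_nonneg_left hvN (weight_nonneg hη)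
    have h4 : weight η / η ^ N * v ^ N + ∑ n ∈ Finset.range (N + 1), |bernoulliCoeff n| * 2 ^ n *
        (η ^ n / η ^ (N + 1)) * v ^ N = C₂ * v ^ N := by
      rw [hC₂, ← Finset.sum_mul, ← Finset.sum_mul]
      field_simp
    calc _ ≤ _ := h1
      _ ≤ _ := add_le_add h3 h2
      _ = C₂ * v ^ N := h4
      _ ≤ _ := by gcongr; exact le_max_right _ _

/-! ### Gaussian moments and the regularized logarithmic integral -/

lemma integrableOn_rpow_mul_gaussian {x q : ℝ} (hx : 0 < x) (hq : -1 < q) :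
    IntegrableOn (fun v : ℝ => v ^ q * exp (-(v ^ 2 / (4 * x)))) (Ioi 0) := by
  have := integrableOn_rpow_mul_exp_neg_mul_rpow (p := 2) (s := q) (b := 1 / (4 * x)) hq
    (by norm_num) (by positivity)
  refine this.congr_fun (fun v _ => ?_) measurableSet_Ioi
  simp only [rpow_two]
  congr 2; ring

lemma integral_rpow_mul_gaussian {x q : ℝ} (hx : 0 < x) (hq : -1 < q) :
    ∫ v in Ioi (0 : ℝ), v ^ q * exp (-(v ^ 2 / (4 * x))) =
      (4 * x) ^ ((q + 1) / 2) * (1 / 2) * Gamma ((q + 1) / 2) := by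
  have := integral_rpow_mul_exp_neg_mul_rpow (p := 2) (q := q) (b := 1 / (4 * x)) two_pos hq
    (by positivity)
  rw [one_div, inv_rpow (by positivity), ← rpow_neg (by positivity), neg_div, neg_neg] at this
  rw [← this]
  refine setIntegral_congr_fun measurableSet_Ioi (fun v _ => ?_)
  simp only [rpow_two]
  congr 2; ring

lemma integrableOn_gaussian_mul_pow {x : ℝ} (hx : 0 < x) (n : ℕ) :
    IntegrableOn (fun v : ℝ => exp (-(v ^ 2 / (4 * x))) * v ^ n) (Ioi 0) := by
  refine (integrableOn_rpow_mul_gaussian (q := n) hx (by linarith [n.cast_nonneg (α := ℝ)])).congr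
    (Eventually.of_forall fun v => ?_)
  simp only [rpow_natCast]
  ring

lemma integral_gaussian_mul_pow {x : ℝ} (hx : 0 < x) (n : ℕ) :
    ∫ v in Ioi (0 : ℝ), exp (-(v ^ 2 / (4 * x))) * v ^ n =
      (2 * √x) ^ (n + 1) * Gamma (((n + 1 : ℕ) : ℝ) / 2) / 2 := by
  have h := integral_rpow_mul_gaussian (q := n) hx (by linarith [n.cast_nonneg (α := ℝ)])
  have h2 : (4 * x) ^ (((n : ℝ) + 1) / 2) = (2 * √x) ^ (n + 1) := by
    rw [show (2 * √x) = √(4 * x) by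
      rw [sqrt_mul (by norm_num), show (4 : ℝ) = 2 ^ 2 by norm_num, sqrt_sq (by norm_num)],
      sqrt_eq_rpow, ← rpow_natCast, ← rpow_mul (by positivity)]
    congr 1; push_cast; ring
  rw [h2] at h
  push_cast
  rw [show (2 * √x) ^ (n + 1) * Gamma (((n : ℝ) + 1) / 2) / 2 =
    (2 * √x) ^ (n + 1) * (1 / 2) * Gamma (((n : ℝ) + 1) / 2) by ring, ← h]
  refine integral_congr_ae (Eventually.of_forall fun v => ?_)
  simp only [rpow_natCast]
  ring

@[fun_prop]
lemma measurable_weightPoly (N : ℕ) : Measurable (weightPoly N) := by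
  unfold weightPoly; fun_prop

lemma integrableOn_gaussian_mul_remainder {x : ℝ} (hx : 0 < x) (N : ℕ) :
    IntegrableOn (fun v : ℝ => exp (-(v ^ 2 / (4 * x))) * (weight v - weightPoly N v))
      (Ioi 0) := by
  obtain ⟨C, hC⟩ := exists_abs_weight_sub_weightPoly_le N
  refine ((integrableOn_gaussian_mul_pow hx N).const_mul C).mono'
    (Measurable.aestronglyMeasurable (by fun_prop)) ?_
  filter_upwards [ae_restrict_mem measurableSet_Ioi] with v hv
  rw [norm_mul, norm_of_nonneg (exp_pos _).le, mul_left_comm]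
  exact mul_le_mul_of_nonneg_left (hC v hv) (exp_pos _).le

/-- The integrand of the regularized logarithmic integral. -/
def logKernel (x v : ℝ) : ℝ := exp (-(v ^ 2 / (4 * x))) / v - planck v

/-- Neither half of `logKernel` is integrable at `0`. Since `weightPoly 0 v = 1/v`, the kernel is
the difference of two functions already known to be integrable. -/
lemma integrableOn_logKernel {x : ℝ} (hx : 0 < x) : IntegrableOn (logKernel x) (Ioi 0) := by
  refine ((integrableOn_exp_mul_weight_sub_planck hx).sub
    (integrableOn_gaussian_mul_remainder hx 0)).congr_fun (fun v hv => ?_) measurableSet_Ioi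
  simp only [Pi.sub_apply, weightPoly_eq_sum (N := 0) hv, logKernel]
  simp
  ring

lemma planck_nonneg {v : ℝ} (hv : 0 < v) : 0 ≤ planck v :=
  div_nonneg (by positivity) (one_sub_exp_pos hv).le

/-- Needed because `v^ε ≤ 1 + v` for `0 < ε < 1`, which dominates `v^ε * logKernel x v` as `ε → 0⁺`.
-/
lemma integrableOn_mul_logKernel {x : ℝ} (hx : 0 < x) :
    IntegrableOn (fun v => v * logKernel x v) (Ioi 0) := by
  have h1 := integrableOn_gaussian_mul_pow hx 0
  have h2 := integrableOn_one_add_mul_exp (m := 1) one_pos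
  refine (h1.add h2).mono' (Measurable.aestronglyMeasurable (by unfold logKernel; fun_prop)) ?_
  filter_upwards [ae_restrict_mem measurableSet_Ioi] with v hv
  have hv' : 0 < v := hv
  have h3 : v * logKernel x v = exp (-(v ^ 2 / (4 * x))) - v * planck v := by
    rw [logKernel]; field_simp
  have h4 : v * planck v ≤ (1 + 2 * v) * exp (-(2 * v)) := by
    have := mul_le_mul_of_nonneg_right (two_div_one_sub_exp_le hv') (exp_pos (-(2 * v))).le
    have h5 := mul_le_mul_of_nonneg_left this hv'.le
    calc v * planck v = v * (2 / (1 - exp (-(2 * v))) * exp (-(2 * v))) := by rw [planck]; ring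
      _ ≤ _ := h5
      _ = _ := by field_simp
  rw [h3]
  refine (norm_sub_le _ _).trans ?_
  rw [norm_of_nonneg (exp_pos _).le, norm_of_nonneg (mul_nonneg hv'.le (planck_nonneg hv'))]
  simpa using h4

lemma tendsto_integral_rpow_mul_logKernel {x : ℝ} (hx : 0 < x) :
    Tendsto (fun ε : ℝ => ∫ v in Ioi (0 : ℝ), v ^ ε * logKernel x v) (𝓝[>] 0)
      (𝓝 (∫ v in Ioi (0 : ℝ), logKernel x v)) := by
  refine tendsto_integral_filter_of_dominated_convergence
    (fun v => ‖logKernel x v‖ + ‖v * logKernel x v‖) ?_ ?_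
    ((integrableOn_logKernel hx).norm.add (integrableOn_mul_logKernel hx).norm) ?_
  · exact Eventually.of_forall fun ε =>
      Measurable.aestronglyMeasurable (by unfold logKernel; fun_prop)
  · filter_upwards [Ioo_mem_nhdsGT (one_pos (α := ℝ))] with ε hε
    filter_upwards [ae_restrict_mem measurableSet_Ioi] with v hv
    have hv' : 0 < v := hv
    rw [norm_mul, norm_mul, ← one_add_mul]
    refine mul_le_mul_of_nonneg_right ?_ (norm_nonneg _)
    rw [norm_of_nonneg (rpow_nonneg hv'.le _), norm_of_nonneg hv'.le]
    rcases le_total v 1 with h | h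
    · linarith [rpow_le_one hv'.le h hε.1.le]
    · have := rpow_le_rpow_of_exponent_le h hε.2.le
      rw [rpow_one] at this
      linarith
  · filter_upwards [ae_restrict_mem measurableSet_Ioi] with v hv
    have hv' : 0 < v := hv
    have h1 : Tendsto (fun ε : ℝ => v ^ ε) (𝓝[>] 0) (𝓝 1) := by
      have := ((continuous_const_rpow hv'.ne').tendsto (0 : ℝ)).mono_left
        (nhdsWithin_le_nhds (s := Ioi 0))
      simpa using this
    simpa using h1.mul_const (logKernel x v)

/-- Expand `planck v = ∑ 2 exp (-2(i+1)v)` and integrate termwise. -/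
lemma mellin_planck {s : ℂ} (hs : 1 < s.re) :
    mellin (fun v => (planck v : ℂ)) s = Complex.Gamma s * (2 * (2 : ℂ) ^ (-s)) * riemannZeta s := by
  have h := hasSum_mellin (a := fun _ : ℕ => (2 : ℂ)) (p := fun i : ℕ => 2 * ((i : ℝ) + 1))
    (F := fun v => (planck v : ℂ)) (s := s) (fun i => Or.inr (by positivity)) (by linarith)
    (fun t ht => ?_) ?_
  · rw [← h.tsum_eq, zeta_eq_tsum_one_div_nat_add_one_cpow hs, ← tsum_mul_left]
    congr 1
    funext i
    rw [Complex.ofReal_mul, Complex.mul_cpow_ofReal_nonneg zero_le_two (by positivity),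
      Complex.cpow_neg]
    push_cast
    field_simp
  · have ht' : 0 < t := ht
    have hr := hasSum_geometric_of_lt_one (exp_pos (-(2 * t))).le
      (by linarith [one_sub_exp_pos ht'])
    have h2 := hr.mul_left (2 * exp (-(2 * t)))
    rw [← div_eq_mul_inv] at h2
    have h3 : HasSum (fun i : ℕ => 2 * exp (-(2 * ((i : ℝ) + 1)) * t)) (planck t) := by
      refine h2.congr_fun fun i => ?_
      rw [← exp_nat_mul, mul_assoc, ← exp_add]
      ring_nf
    have := Complex.hasSum_ofReal.2 h3
    simpa using this
  · have h1 := (summable_nat_add_iff 1).2 (Real.summable_one_div_nat_rpow.2 hs)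
    refine (h1.mul_left (2 / 2 ^ s.re)).congr fun i => ?_
    rw [mul_rpow zero_le_two (by positivity)]
    push_cast
    simp only [Complex.norm_ofNat]
    field_simp

lemma integral_rpow_mul_logKernel {x ε : ℝ} (hx : 0 < x) (hε : 0 < ε) (hε1 : ε < 1) :
    ((∫ v in Ioi (0 : ℝ), v ^ ε * logKernel x v : ℝ) : ℂ) =
      (((4 * x) ^ (ε / 2) * (1 / 2) * Gamma (ε / 2) : ℝ) : ℂ) -
        mellin (fun v => (planck v : ℂ)) (1 + ε) := by
  have h1 := integrableOn_rpow_mul_gaussian (q := ε - 1) hx (by linarith)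
  have h2 : IntegrableOn (fun v => v ^ ε * logKernel x v) (Ioi 0) := by
    refine ((integrableOn_logKernel hx).norm.add (integrableOn_mul_logKernel hx).norm).mono'
      (Measurable.aestronglyMeasurable (by unfold logKernel; fun_prop)) ?_
    filter_upwards [ae_restrict_mem measurableSet_Ioi] with v hv
    have hv' : 0 < v := hv
    rw [Pi.add_apply, norm_mul, norm_mul, ← one_add_mul]
    refine mul_le_mul_of_nonneg_right ?_ (norm_nonneg _)
    rw [norm_of_nonneg (rpow_nonneg hv'.le _), norm_of_nonneg hv'.le]
    rcases le_total v 1 with h | h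
    · linarith [rpow_le_one hv'.le h hε.le]
    · have := rpow_le_rpow_of_exponent_le h hε1.le
      rw [rpow_one] at this
      linarith
  have h3 : mellin (fun v => (planck v : ℂ)) (1 + ε) =
      ((∫ v in Ioi (0 : ℝ), (v ^ (ε - 1) * exp (-(v ^ 2 / (4 * x))) - v ^ ε * logKernel x v) : ℝ)
        : ℂ) := by
    rw [mellin, ← integral_complex_ofReal]
    refine setIntegral_congr_fun measurableSet_Ioi (fun v hv => ?_)
    have hv' : 0 < v := hv
    rw [add_sub_cancel_left, ← Complex.ofReal_cpow hv'.le, smul_eq_mul, ← Complex.ofReal_mul,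
      rpow_sub_one hv'.ne', logKernel]
    congr 1
    ring
  rw [h3, integral_sub h1 h2, integral_rpow_mul_gaussian hx (by linarith)]
  push_cast
  rw [sub_add_cancel]
  ring

/-- Inserting `v^ε` allows the two halves to be integrated separately. They are `(4x)^(ε/2) Γ(1+ε/2)
/ ε` and `2^(-ε) Γ(1+ε) ζ(1+ε)`, where `ζ(1+ε) = 1/ε + γ + o(1)`. The poles cancel, and the limit is
the difference of two derivatives at `0`, less `γ`. -/
lemma integral_logKernel {x : ℝ} (hx : 0 < x) :
    ∫ v in Ioi (0 : ℝ), logKernel x v =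
      Real.log (4 * x) / 2 + Real.log 2 - eulerMascheroniConstant / 2 := by
  have hx4 : (0 : ℝ) < 4 * x := by positivity
  have hD1 : HasDerivAt (fun ε : ℂ => ((4 * x : ℝ) : ℂ) ^ (ε / 2) * Complex.Gamma (1 + ε / 2))
      (Real.log (4 * x) / 2 - eulerMascheroniConstant / 2) 0 := by
    have ha : HasDerivAt (fun ε : ℂ => ((4 * x : ℝ) : ℂ) ^ (ε / 2))
        (((4 * x : ℝ) : ℂ) ^ ((0 : ℂ) / 2) * Complex.log ((4 * x : ℝ) : ℂ) * (1 / 2)) 0 :=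
      ((hasDerivAt_id (0 : ℂ)).div_const 2).const_cpow
        (Or.inl (Complex.ofReal_ne_zero.2 hx4.ne'))
    have hb : HasDerivAt (fun ε : ℂ => Complex.Gamma (1 + ε / 2))
        (-eulerMascheroniConstant * (1 / 2)) 0 := by
      have h0 : HasDerivAt Complex.Gamma (-eulerMascheroniConstant) (1 + (0 : ℂ) / 2) := by
        simpa using Complex.hasDerivAt_Gamma_one
      exact h0.comp (0 : ℂ) (((hasDerivAt_id (0 : ℂ)).div_const 2).const_add 1)
    convert! ha.mul hb using 1
    rw [← Complex.ofReal_log hx4.le]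
    simp
    ring
  have hD2 : HasDerivAt (fun ε : ℂ => (2 : ℂ) ^ (-ε) * Complex.Gamma (1 + ε))
      (-Real.log 2 - eulerMascheroniConstant) 0 := by
    have ha : HasDerivAt (fun ε : ℂ => (2 : ℂ) ^ (-ε))
        ((2 : ℂ) ^ (-(0 : ℂ)) * Complex.log 2 * (-1)) 0 :=
      (hasDerivAt_id (0 : ℂ)).neg.const_cpow (Or.inl two_ne_zero)
    have hb : HasDerivAt (fun ε : ℂ => Complex.Gamma (1 + ε)) (-eulerMascheroniConstant : ℂ) 0 := by
      have h0 : HasDerivAt Complex.Gamma (-eulerMascheroniConstant) (1 + (0 : ℂ)) := by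
        simpa using Complex.hasDerivAt_Gamma_one
      exact h0.comp_const_add 1 0
    convert! ha.mul hb using 1
    rw [show Complex.log 2 = ((Real.log 2 : ℝ) : ℂ) by
      rw [Complex.ofReal_log zero_le_two]; simp]
    simp
    ring
  have hslope := (hD1.sub hD2).tendsto_slope_zero
  have hcont : Tendsto (fun ε : ℂ => (2 : ℂ) ^ (-ε) * Complex.Gamma (1 + ε)) (𝓝[≠] 0) (𝓝 1) := by
    have := hD2.continuousAt.tendsto.mono_left (nhdsWithin_le_nhds (s := {0}ᶜ))
    simpa using this
  have hzeta : Tendsto (fun ε : ℂ => riemannZeta (1 + ε) - 1 / ε) (𝓝[≠] 0)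
      (𝓝 eulerMascheroniConstant) := by
    have hmap : Tendsto (fun ε : ℂ => 1 + ε) (𝓝[≠] 0) (𝓝[≠] 1) := by
      refine tendsto_nhdsWithin_iff.2 ⟨?_, ?_⟩
      · have : Continuous (fun ε : ℂ => 1 + ε) := by fun_prop
        simpa using (this.tendsto 0).mono_left (nhdsWithin_le_nhds (s := {0}ᶜ))
      · filter_upwards [self_mem_nhdsWithin] with ε hε
        simpa using hε
    have := tendsto_riemannZeta_sub_one_div.comp hmap
    refine this.congr fun ε => ?_
    simp
  have hreal : Tendsto (fun ε : ℝ => (ε : ℂ)) (𝓝[>] 0) (𝓝[≠] 0) := by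
    refine tendsto_nhdsWithin_iff.2 ⟨?_, ?_⟩
    · have := (Complex.continuous_ofReal.tendsto 0).mono_left (nhdsWithin_le_nhds (s := Ioi 0))
      simpa using this
    · filter_upwards [self_mem_nhdsWithin] with ε hε
      simpa using (ne_of_gt hε : ε ≠ 0)
  have hlim := (hslope.sub (hcont.mul hzeta)).comp hreal
  have hleft := (Complex.continuous_ofReal.tendsto _).comp (tendsto_integral_rpow_mul_logKernel hx)
  have hval : ((∫ v in Ioi (0 : ℝ), logKernel x v : ℝ) : ℂ) =
      (Real.log (4 * x) / 2 - eulerMascheroniConstant / 2) -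
        (-Real.log 2 - eulerMascheroniConstant) - 1 * eulerMascheroniConstant := by
    refine tendsto_nhds_unique hleft (hlim.congr' ?_)
    filter_upwards [Ioo_mem_nhdsGT (one_pos (α := ℝ))] with ε hε
    have hε0 : (ε : ℂ) ≠ 0 := Complex.ofReal_ne_zero.2 hε.1.ne'
    simp only [Function.comp]
    rw [integral_rpow_mul_logKernel hx hε.1 hε.2, mellin_planck (by simpa using hε.1)]
    have hG : Complex.Gamma (1 + ε / 2) = ε / 2 * Complex.Gamma (ε / 2) := by
      rw [add_comm, Complex.Gamma_add_one _ (div_ne_zero hε0 two_ne_zero)]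
    have h2 : (2 : ℂ) ^ (-(1 + (ε : ℂ))) = (2 : ℂ) ^ (-(ε : ℂ)) / 2 := by
      rw [neg_add, Complex.cpow_add _ _ two_ne_zero, Complex.cpow_neg_one]; ring
    have h3 : (((4 * x) ^ (ε / 2) : ℝ) : ℂ) = ((4 * x : ℝ) : ℂ) ^ ((ε : ℂ) / 2) := by
      rw [Complex.ofReal_cpow hx4.le]; push_cast; rfl
    have h4 : (((4 * x) ^ (ε / 2) * (1 / 2) * Gamma (ε / 2) : ℝ) : ℂ) =
        ((4 * x : ℝ) : ℂ) ^ ((ε : ℂ) / 2) * (1 / 2) * Complex.Gamma ((ε : ℂ) / 2) := by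
      rw [← h3, Complex.ofReal_mul, Complex.ofReal_mul, ← Complex.Gamma_ofReal]
      simp
    rw [h2, h4]
    simp only [Pi.sub_apply, zero_add, smul_eq_mul, zero_div, neg_zero, Complex.cpow_zero, add_zero,
      Complex.Gamma_one, hG]
    field_simp
    ring
  have := congrArg Complex.re hval
  rw [Complex.ofReal_re] at this
  rw [this]
  have h9 : ((Real.log (4 * x) / 2 - eulerMascheroniConstant / 2 : ℂ) -
        (-Real.log 2 - eulerMascheroniConstant) - 1 * eulerMascheroniConstant) =
      ((Real.log (4 * x) / 2 + Real.log 2 - eulerMascheroniConstant / 2 : ℝ) : ℂ) := by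
    push_cast; ring
  rw [h9, Complex.ofReal_re]

/-! ### Expansion of `Phi` at the origin -/

/-- The coefficient of `x^{(n-1)/2}` in the expansion of `Phi x` at the origin. -/
def phiCoeff (n : ℕ) : ℝ := bernoulliCoeff n * 4 ^ n * Gamma ((n : ℝ) / 2) / (8 * √π)

/-- The leading part of `Phi x` at the origin. -/
def phiLead (x : ℝ) : ℝ :=
  (eulerMascheroniConstant + Real.log (16 * π ^ 2 * x)) / (8 * √π) * x ^ (-(1 / 2) : ℝ)

/-- The remainder in the expansion of `Phi x` at the origin. -/
def phiRem (N : ℕ) (x : ℝ) : ℝ :=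
  1 / (4 * √(π * x)) *
    ∫ v in Ioi (0 : ℝ), exp (-(v ^ 2 / (4 * x))) * (weight v - weightPoly N v)

lemma integral_exp_mul_weight_sub_planck {x : ℝ} (hx : 0 < x) (N : ℕ) :
    ∫ v in Ioi (0 : ℝ), (exp (-(v ^ 2 / (4 * x))) * weight v - planck v) =
      Real.log (4 * x) / 2 + Real.log 2 - eulerMascheroniConstant / 2 +
      ∑ n ∈ Finset.Icc 1 N, bernoulliCoeff n * 2 ^ n *
        ((2 * √x) ^ n * Gamma ((n : ℝ) / 2) / 2) +
      ∫ v in Ioi (0 : ℝ), exp (-(v ^ 2 / (4 * x))) * (weight v - weightPoly N v) := by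
  have hint : ∀ n ∈ Finset.Icc 1 N, IntegrableOn (fun v : ℝ => bernoulliCoeff n * 2 ^ n *
      (exp (-(v ^ 2 / (4 * x))) * v ^ (n - 1))) (Ioi 0) := fun n _ =>
    (integrableOn_gaussian_mul_pow hx (n - 1)).const_mul _
  have h1 : ∫ v in Ioi (0 : ℝ), ∑ n ∈ Finset.Icc 1 N, bernoulliCoeff n * 2 ^ n *
      (exp (-(v ^ 2 / (4 * x))) * v ^ (n - 1)) = ∑ n ∈ Finset.Icc 1 N, bernoulliCoeff n * 2 ^ n *
        ((2 * √x) ^ n * Gamma ((n : ℝ) / 2) / 2) := by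
    rw [integral_finsetSum _ hint]
    refine Finset.sum_congr rfl fun n hn => ?_
    have hn' : n - 1 + 1 = n := by have := Finset.mem_Icc.1 hn; omega
    rw [integral_const_mul, integral_gaussian_mul_pow hx, hn']
  have h3 := integral_add ((integrableOn_logKernel hx).add (integrable_finsetSum _ hint))
    (integrableOn_gaussian_mul_remainder hx N)
  simp only [Pi.add_apply] at h3
  rw [← h1, ← integral_logKernel hx, ← integral_add (integrableOn_logKernel hx)
    (integrable_finsetSum _ hint), ← h3]
  refine setIntegral_congr_fun measurableSet_Ioi (fun v hv => ?_)
  simp only [weightPoly_eq_sum (N := N) hv, logKernel]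
  have h2 : ∑ n ∈ Finset.Icc 1 N, bernoulliCoeff n * 2 ^ n *
      (exp (-(v ^ 2 / (4 * x))) * v ^ (n - 1)) = exp (-(v ^ 2 / (4 * x))) *
        ∑ n ∈ Finset.Icc 1 N, bernoulliCoeff n * 2 ^ n * v ^ (n - 1) := by
    rw [Finset.mul_sum]
    exact Finset.sum_congr rfl fun n _ => by ring
  rw [h2]
  ring

/-- The expansion of `Phi x` at the origin. -/
theorem Phi_eq_expansion {x : ℝ} (hx : 0 < x) (N : ℕ) :
    Phi x = phiLead x + ∑ n ∈ Finset.Icc 1 N, phiCoeff n * x ^ (((n : ℝ) - 1) / 2) +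
      phiRem N x := by
  rw [Phi_eq_integral hx, integral_exp_mul_weight_sub_planck hx N, phiRem, phiLead]
  have hs : 0 < √x := by positivity
  have hp : 0 < √π := by positivity
  have h1 : x ^ (-(1 / 2) : ℝ) = 1 / √x := by
    rw [rpow_neg hx.le, sqrt_eq_rpow, one_div, one_div]
  -- The constant `log π + γ` and the value of the logarithmic integral add up to half of `γ + log
  -- (16 π² x)`.
  have h2 : Real.log (16 * π ^ 2 * x) = 2 * Real.log 2 + 2 * Real.log π + Real.log (4 * x) := by
    rw [show 16 * π ^ 2 * x = 2 ^ 2 * π ^ 2 * (4 * x) by ring, Real.log_mul (by positivity)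
      (by positivity), Real.log_mul (by positivity) (by positivity), Real.log_pow, Real.log_pow]
    push_cast; ring
  have h3 : ∀ n : ℕ, phiCoeff n * x ^ (((n : ℝ) - 1) / 2) = 1 / (4 * (√π * √x)) *
      (bernoulliCoeff n * 2 ^ n * ((2 * √x) ^ n * Gamma ((n : ℝ) / 2) / 2)) := by
    intro n
    have : x ^ (((n : ℝ) - 1) / 2) = √x ^ n / √x := by
      rw [sqrt_eq_rpow, ← rpow_natCast, ← rpow_mul hx.le, ← rpow_sub hx]
      congr 1; ring
    rw [this, phiCoeff, mul_pow, show (4 : ℝ) ^ n = 2 ^ n * 2 ^ n by rw [← mul_pow]; norm_num]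
    field_simp
    ring
  rw [Finset.sum_congr rfl fun n _ => h3 n, ← Finset.mul_sum, sqrt_mul pi_pos.le, h1, h2]
  field_simp
  ring

lemma measurable_phiRem (N : ℕ) : Measurable (phiRem N) := by
  have h : StronglyMeasurable (Function.uncurry fun x v : ℝ =>
      exp (-(v ^ 2 / (4 * x))) * (weight v - weightPoly N v)) := by
    refine Measurable.stronglyMeasurable ?_
    unfold Function.uncurry
    fun_prop
  have h2 := (h.integral_prod_right (ν := volume.restrict (Ioi (0 : ℝ)))).measurable
  unfold phiRem
  exact Measurable.mul (by fun_prop) h2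

lemma exists_abs_phiRem_le (N : ℕ) :
    ∃ C, 0 ≤ C ∧ ∀ x : ℝ, 0 < x → |phiRem N x| ≤ C * x ^ ((N : ℝ) / 2) := by
  obtain ⟨C, hC⟩ := exists_abs_weight_sub_weightPoly_le N
  have hC0 : 0 ≤ C := by
    have := (abs_nonneg _).trans (hC 1 one_pos)
    simpa using this
  refine ⟨1 / (4 * √π) * (C * (2 ^ (N + 1) * Gamma (((N + 1 : ℕ) : ℝ) / 2) / 2)), ?_,
    fun x hx => ?_⟩
  · have := Gamma_pos_of_pos (show 0 < ((N + 1 : ℕ) : ℝ) / 2 by positivity)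
    positivity
  · have h1 : |∫ v in Ioi (0 : ℝ), exp (-(v ^ 2 / (4 * x))) * (weight v - weightPoly N v)| ≤
        C * ((2 * √x) ^ (N + 1) * Gamma (((N + 1 : ℕ) : ℝ) / 2) / 2) := by
      rw [← integral_gaussian_mul_pow hx, ← integral_const_mul]
      rw [← Real.norm_eq_abs]
      refine norm_integral_le_of_norm_le ((integrableOn_gaussian_mul_pow hx N).const_mul C) ?_
      filter_upwards [ae_restrict_mem measurableSet_Ioi] with v hv
      rw [norm_mul, norm_of_nonneg (exp_pos _).le, mul_left_comm]
      exact mul_le_mul_of_nonneg_left (hC v hv) (exp_pos _).le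
    have hs : 0 < √x := by positivity
    have h2 : x ^ ((N : ℝ) / 2) = √x ^ N := by
      rw [sqrt_eq_rpow, ← rpow_natCast, ← rpow_mul hx.le]
      congr 1; ring
    rw [phiRem, abs_mul, abs_of_pos (by positivity), sqrt_mul pi_pos.le, h2]
    calc _ ≤ 1 / (4 * (√π * √x)) * (C * ((2 * √x) ^ (N + 1) *
          Gamma (((N + 1 : ℕ) : ℝ) / 2) / 2)) := by gcongr
      _ = _ := by rw [mul_pow, pow_succ √x]; field_simp

/-- Both sides come from expanding the same `Phi x` to lengths `N` and `N + 1`. -/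
lemma phiRem_eq_add {x : ℝ} (hx : 0 < x) (N : ℕ) :
    phiRem N x = phiCoeff (N + 1) * x ^ ((N : ℝ) / 2) + phiRem (N + 1) x := by
  have h1 := Phi_eq_expansion hx N
  have h2 := Phi_eq_expansion hx (N + 1)
  rw [Finset.sum_Icc_succ_top (by omega)] at h2
  push_cast at h2
  rw [add_sub_cancel_right] at h2
  linarith

/-! ### Mellin transforms over `(0, a]` -/

lemma mellinConvergent_indicator_Ioc_iff {a : ℝ} {F : ℝ → ℂ} {s : ℂ} :
    MellinConvergent (indicator (Ioc 0 a) F) s ↔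
      IntegrableOn (fun x : ℝ => F x * (x : ℂ) ^ (s - 1)) (Ioc 0 a) := by
  rw [MellinConvergent]
  simp_rw [← indicator_smul, smul_eq_mul, mul_comm _ (F _)]
  rw [IntegrableOn, integrable_indicator_iff measurableSet_Ioc, IntegrableOn,
    Measure.restrict_restrict_of_subset Ioc_subset_Ioi_self, IntegrableOn]

lemma mellin_indicator_Ioc {a : ℝ} (F : ℝ → ℂ) (s : ℂ) :
    mellin (indicator (Ioc 0 a) F) s = ∫ x in Ioc 0 a, F x * (x : ℂ) ^ (s - 1) := by
  rw [mellin]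
  simp_rw [← indicator_smul, smul_eq_mul, mul_comm _ (F _)]
  rw [integral_indicator measurableSet_Ioc,
    Measure.restrict_restrict_of_subset Ioc_subset_Ioi_self]

/-- The cutoff kills the behaviour at infinity, so the half-plane is dictated by the power bound at
`0` alone. -/
lemma mellin_indicator_hasDerivAt {a c C : ℝ} {F : ℝ → ℂ} (hF : Measurable F)
    (hb : ∀ x : ℝ, 0 < x → ‖F x‖ ≤ C * x ^ c) {s : ℂ} (hs : -c < s.re) :
    MellinConvergent (indicator (Ioc 0 a) F) s ∧
    MellinConvergent (fun t => Real.log t • indicator (Ioc 0 a) F t) s ∧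
      HasDerivAt (mellin (indicator (Ioc 0 a) F))
        (mellin (fun t => Real.log t • indicator (Ioc 0 a) F t) s) s := by
  have hle : ∀ x, ‖indicator (Ioc 0 a) F x‖ ≤ ‖C * x ^ c‖ := by
    intro x
    by_cases hx : x ∈ Ioc 0 a
    · rw [indicator_of_mem hx]
      exact (hb x hx.1).trans (le_abs_self _)
    · rw [indicator_of_notMem hx, norm_zero]
      exact norm_nonneg _
  have hloc : LocallyIntegrableOn (indicator (Ioc 0 a) F) (Ioi 0) := by
    have hc : LocallyIntegrableOn (fun x : ℝ => C * x ^ c) (Ioi 0) := by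
      refine ContinuousOn.locallyIntegrableOn ?_ measurableSet_Ioi
      exact ContinuousOn.mul continuousOn_const
        (ContinuousOn.rpow_const continuousOn_id fun x hx => Or.inl (ne_of_gt hx))
    exact hc.mono (hF.indicator measurableSet_Ioc).aestronglyMeasurable
      (Eventually.of_forall hle)
  have htop : indicator (Ioc 0 a) F =O[atTop] (fun x : ℝ => x ^ (-(s.re + 1))) := by
    refine Asymptotics.IsBigO.of_bound 0 ?_
    filter_upwards [eventually_gt_atTop a] with x hx
    rw [indicator_of_notMem (fun h => absurd h.2 (not_le.2 hx))]
    simp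
  have hbot : indicator (Ioc 0 a) F =O[𝓝[>] 0] (fun x : ℝ => x ^ (-(-c))) := by
    refine Asymptotics.IsBigO.of_bound ‖C‖ (Eventually.of_forall fun x => ?_)
    rw [neg_neg, ← norm_mul]
    exact hle x
  exact ⟨mellinConvergent_of_isBigO_rpow hloc htop (by linarith) hbot hs,
    mellin_hasDerivAt_of_isBigO_rpow hloc htop (by linarith) hbot hs⟩

lemma integrableOn_cpow_Ioc {a : ℝ} (ha : 0 < a) {p : ℂ} (hp : 0 < p.re) :
    IntegrableOn (fun x : ℝ => (x : ℂ) ^ (p - 1)) (Ioc 0 a) := by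
  rw [← intervalIntegrable_iff_integrableOn_Ioc_of_le ha.le]
  exact intervalIntegral.intervalIntegrable_cpow' (by simpa using hp)

lemma integral_cpow_Ioc {a : ℝ} (ha : 0 < a) {p : ℂ} (hp : 0 < p.re) :
    ∫ x in Ioc 0 a, (x : ℂ) ^ (p - 1) = (a : ℂ) ^ p / p := by
  have hp0 : p ≠ 0 := by rintro rfl; simp at hp
  rw [← intervalIntegral.integral_of_le ha.le, integral_cpow (Or.inl (by simpa using hp)),
    sub_add_cancel, Complex.ofReal_zero, Complex.zero_cpow hp0, sub_zero]

/-- The logarithm arises by differentiating `∫ x^(p-1) = a^p / p` in `p` under the integral sign. -/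
lemma log_mul_cpow_Ioc {a : ℝ} (ha : 0 < a) {p : ℂ} (hp : 0 < p.re) :
    IntegrableOn (fun x : ℝ => (Real.log x : ℂ) * (x : ℂ) ^ (p - 1)) (Ioc 0 a) ∧
    ∫ x in Ioc 0 a, (Real.log x : ℂ) * (x : ℂ) ^ (p - 1) =
      (a : ℂ) ^ p * (Real.log a / p - 1 / p ^ 2) := by
  have hp0 : p ≠ 0 := by rintro rfl; simp at hp
  have ha0 : (a : ℂ) ≠ 0 := Complex.ofReal_ne_zero.2 ha.ne'
  obtain ⟨-, h2, h3⟩ := mellin_indicator_hasDerivAt (a := a) (c := 0) (C := 1)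
    (F := fun _ => (1 : ℂ)) measurable_const (fun x _ => by simp) (s := p) (by simpa using hp)
  have hfun : (fun t : ℝ => Real.log t • indicator (Ioc 0 a) (fun _ => (1 : ℂ)) t) =
      indicator (Ioc 0 a) (fun t : ℝ => (Real.log t : ℂ)) := by
    funext t
    by_cases ht : t ∈ Ioc 0 a
    · simp [indicator_of_mem ht]
    · simp [indicator_of_notMem ht]
  rw [hfun] at h2 h3
  rw [mellinConvergent_indicator_Ioc_iff] at h2
  refine ⟨h2, ?_⟩
  rw [mellin_indicator_Ioc] at h3
  have h4 : HasDerivAt (fun p : ℂ => (a : ℂ) ^ p / p)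
      (((a : ℂ) ^ p * Complex.log a * 1 * p - (a : ℂ) ^ p * 1) / p ^ 2) p :=
    ((hasDerivAt_id p).const_cpow (Or.inl ha0)).div (hasDerivAt_id p) hp0
  have h5 : mellin (indicator (Ioc 0 a) fun _ => (1 : ℂ)) =ᶠ[𝓝 p] fun p : ℂ => (a : ℂ) ^ p / p := by
    have hopen : IsOpen {q : ℂ | 0 < q.re} := isOpen_lt continuous_const Complex.continuous_re
    filter_upwards [hopen.mem_nhds hp] with q hq
    rw [mellin_indicator_Ioc]
    simpa using integral_cpow_Ioc ha hq
  have h6 := h3.unique (h4.congr_of_eventuallyEq h5)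
  rw [h6, ← Complex.ofReal_log ha.le]
  field_simp

/-- The truncated Mellin transform of the remainder of `Phi`. -/
def remMellin (N : ℕ) (a : ℝ) (s : ℂ) : ℂ :=
  ∫ x in Ioc (0 : ℝ) a, ((phiRem N x : ℝ) : ℂ) * (x : ℂ) ^ (s / 2 - 1)

lemma remMellin_aux (N : ℕ) (a : ℝ) {s : ℂ} (hs : -(N : ℝ) < s.re) :
    IntegrableOn (fun x : ℝ => ((phiRem N x : ℝ) : ℂ) * (x : ℂ) ^ (s / 2 - 1)) (Ioc 0 a) ∧
      DifferentiableAt ℂ (remMellin N a) s := by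
  obtain ⟨C, -, hC⟩ := exists_abs_phiRem_le N
  have hs2 : -((N : ℝ) / 2) < (s / 2).re := by
    rw [show s / 2 = s / (2 : ℝ) by simp, Complex.div_ofReal_re]; linarith
  obtain ⟨h1, -, h3⟩ := mellin_indicator_hasDerivAt (a := a) (c := N / 2) (C := C)
    (F := fun x => ((phiRem N x : ℝ) : ℂ))
    (Complex.measurable_ofReal.comp (measurable_phiRem N))
    (fun x hx => by rw [Complex.norm_real]; exact hC x hx) hs2
  refine ⟨mellinConvergent_indicator_Ioc_iff.1 h1, ?_⟩
  have h4 : remMellin N a =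
      mellin (indicator (Ioc 0 a) fun x => ((phiRem N x : ℝ) : ℂ)) ∘ fun s => s / 2 := by
    funext z
    rw [Function.comp, mellin_indicator_Ioc, remMellin]
  rw [h4]
  exact h3.differentiableAt.comp s (differentiableAt_id.div_const 2)

lemma analyticAt_remMellin (N : ℕ) (a : ℝ) {s : ℂ} (hs : -(N : ℝ) < s.re) :
    AnalyticAt ℂ (remMellin N a) s := by
  have hopen : IsOpen {q : ℂ | -(N : ℝ) < q.re} :=
    isOpen_lt continuous_const Complex.continuous_re
  have hd : DifferentiableOn ℂ (remMellin N a) {q : ℂ | -(N : ℝ) < q.re} := fun z hz =>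
    (remMellin_aux N a hz).2.differentiableWithinAt
  exact hd.analyticAt (hopen.mem_nhds hs)

lemma half_add_re (N : ℕ) (s : ℂ) : (((N : ℂ) + s) / 2).re = ((N : ℝ) + s.re) / 2 := by
  rw [show ((N : ℂ) + s) / 2 = ((N : ℂ) + s) / (2 : ℝ) by simp, Complex.div_ofReal_re]
  simp

lemma exists_norm_remMellin_le (N : ℕ) {s : ℂ} (hs : -(N : ℝ) < s.re) :
    ∃ C, ∀ a : ℝ, 0 < a → ‖remMellin N a s‖ ≤ C * a ^ (((N : ℝ) + s.re) / 2) := by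
  obtain ⟨C, hC0, hC⟩ := exists_abs_phiRem_le N
  set q := ((N : ℝ) + s.re) / 2 with hq
  have hq0 : 0 < q := by rw [hq]; linarith
  refine ⟨C / q, fun a ha => ?_⟩
  have hint : IntegrableOn (fun x : ℝ => x ^ (q - 1)) (Ioc 0 a) := by
    rw [← intervalIntegrable_iff_integrableOn_Ioc_of_le ha.le]
    exact intervalIntegral.intervalIntegrable_rpow' (by linarith)
  have hval : ∫ x in Ioc 0 a, x ^ (q - 1) = a ^ q / q := by
    rw [← intervalIntegral.integral_of_le ha.le, integral_rpow (Or.inl (by linarith)),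
      sub_add_cancel, zero_rpow hq0.ne', sub_zero]
  rw [div_mul_eq_mul_div, mul_div_assoc, ← hval, ← integral_const_mul, remMellin]
  refine norm_integral_le_of_norm_le (hint.const_mul C) ?_
  filter_upwards [ae_restrict_mem measurableSet_Ioc] with x hx
  rw [norm_mul, Complex.norm_real, Complex.norm_cpow_eq_rpow_re_of_pos hx.1]
  have h1 : x ^ (q - 1) = x ^ ((N : ℝ) / 2) * x ^ (s / 2 - 1).re := by
    rw [← rpow_add hx.1]
    congr 1
    rw [show s / 2 = s / (2 : ℝ) by simp, Complex.sub_re, Complex.div_ofReal_re, Complex.one_re]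
    rw [hq]; ring
  rw [h1, ← mul_assoc]
  exact mul_le_mul_of_nonneg_right (hC x hx.1) (rpow_nonneg hx.1.le _)

lemma ofReal_rpow_mul_cpow {x : ℝ} (hx : 0 < x) (N : ℕ) (s : ℂ) :
    ((x ^ ((N : ℝ) / 2) : ℝ) : ℂ) * (x : ℂ) ^ (s / 2 - 1) = (x : ℂ) ^ (((N : ℂ) + s) / 2 - 1) := by
  rw [Complex.ofReal_cpow hx.le, ← Complex.cpow_add _ _ (Complex.ofReal_ne_zero.2 hx.ne')]
  congr 1
  push_cast; ring

lemma remMellin_eq_add (N : ℕ) {a : ℝ} (ha : 0 < a) {s : ℂ} (hs : -(N : ℝ) < s.re) :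
    remMellin N a s = (phiCoeff (N + 1) : ℂ) * (2 * (a : ℂ) ^ (((N : ℂ) + s) / 2) / (N + s)) +
      remMellin (N + 1) a s := by
  have hp : 0 < (((N : ℂ) + s) / 2).re := by rw [half_add_re]; linarith
  have h1 := (integrableOn_cpow_Ioc ha hp).const_mul (phiCoeff (N + 1) : ℂ)
  have h2 := (remMellin_aux (N + 1) a (s := s) (by push_cast; linarith)).1
  have h3 : (phiCoeff (N + 1) : ℂ) * (2 * (a : ℂ) ^ (((N : ℂ) + s) / 2) / (N + s)) =
      ∫ x in Ioc 0 a, (phiCoeff (N + 1) : ℂ) * (x : ℂ) ^ (((N : ℂ) + s) / 2 - 1) := by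
    rw [integral_const_mul, integral_cpow_Ioc ha hp]
    congr 1
    rw [div_div_eq_mul_div, mul_comm]
  rw [h3, remMellin, remMellin, ← integral_add h1 h2]
  refine setIntegral_congr_fun measurableSet_Ioc (fun x hx => ?_)
  simp only [phiRem_eq_add hx.1 N]
  rw [← ofReal_rpow_mul_cpow hx.1]
  push_cast
  ring

lemma phiLead_mul_cpow {x : ℝ} (hx : 0 < x) (s : ℂ) :
    ((phiLead x : ℝ) : ℂ) * (x : ℂ) ^ (s / 2 - 1) =
      ((eulerMascheroniConstant + Real.log (16 * π ^ 2) : ℝ) : ℂ) / (8 * (√π : ℝ)) *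
        (x : ℂ) ^ ((s - 1) / 2 - 1) +
      1 / (8 * (√π : ℝ)) * ((Real.log x : ℂ) * (x : ℂ) ^ ((s - 1) / 2 - 1)) := by
  have h1 : (x : ℂ) ^ ((s - 1) / 2 - 1) =
      ((x ^ (-(1 / 2) : ℝ) : ℝ) : ℂ) * (x : ℂ) ^ (s / 2 - 1) := by
    rw [Complex.ofReal_cpow hx.le, ← Complex.cpow_add _ _ (Complex.ofReal_ne_zero.2 hx.ne')]
    congr 1
    push_cast; ring
  rw [h1, phiLead, Real.log_mul (by positivity) hx.ne']
  push_cast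
  ring

lemma integrableOn_phiLead {a : ℝ} (ha : 0 < a) {s : ℂ} (hs : 1 < s.re) :
    IntegrableOn (fun x : ℝ => ((phiLead x : ℝ) : ℂ) * (x : ℂ) ^ (s / 2 - 1)) (Ioc 0 a) ∧
    ∫ x in Ioc 0 a, ((phiLead x : ℝ) : ℂ) * (x : ℂ) ^ (s / 2 - 1) =
      (a : ℂ) ^ ((s - 1) / 2) / (4 * (√π : ℝ)) * (-2 / (s - 1) ^ 2 +
        ((eulerMascheroniConstant + Real.log (16 * π ^ 2 * a) : ℝ) : ℂ) / (s - 1)) := by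
  have hp : 0 < ((s - 1) / 2).re := by
    rw [show (s - 1) / 2 = (s - 1) / (2 : ℝ) by simp, Complex.div_ofReal_re, Complex.sub_re,
      Complex.one_re]
    linarith
  have hs1 : s - 1 ≠ 0 := by
    intro h
    rw [h] at hp
    simp at hp
  have hpi : ((√π : ℝ) : ℂ) ≠ 0 := Complex.ofReal_ne_zero.2 (by positivity)
  obtain ⟨h1, h2⟩ := log_mul_cpow_Ioc ha hp
  have h3 := (integrableOn_cpow_Ioc ha hp).const_mul
    (((eulerMascheroniConstant + Real.log (16 * π ^ 2) : ℝ) : ℂ) / (8 * (√π : ℝ)))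
  have h4 := h1.const_mul (1 / (8 * ((√π : ℝ) : ℂ)))
  refine ⟨IntegrableOn.congr_fun (h3.add h4) (fun x hx => (phiLead_mul_cpow hx.1 s).symm)
    measurableSet_Ioc, ?_⟩
  rw [setIntegral_congr_fun measurableSet_Ioc (fun x hx => phiLead_mul_cpow hx.1 s),
    integral_add h3 h4, integral_const_mul, integral_const_mul, h2, integral_cpow_Ioc ha hp,
    Real.log_mul (by positivity) ha.ne']
  push_cast
  field_simp
  ring

lemma Phi_eq_phiLead_add {x : ℝ} (hx : 0 < x) : Phi x = phiLead x + phiRem 0 x := by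
  simpa using Phi_eq_expansion hx 0

lemma integral_Phi_mul_cpow {a : ℝ} (ha : 0 < a) {s : ℂ} (hs : 1 < s.re) :
    IntegrableOn (fun x : ℝ => ((Phi x : ℝ) : ℂ) * (x : ℂ) ^ (s / 2 - 1)) (Ioc 0 a) ∧
    ∫ x in Ioc 0 a, ((Phi x : ℝ) : ℂ) * (x : ℂ) ^ (s / 2 - 1) =
      (a : ℂ) ^ ((s - 1) / 2) / (4 * (√π : ℝ)) * (-2 / (s - 1) ^ 2 +
        ((eulerMascheroniConstant + Real.log (16 * π ^ 2 * a) : ℝ) : ℂ) / (s - 1)) +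
      remMellin 0 a s := by
  obtain ⟨h1, h2⟩ := integrableOn_phiLead ha hs
  have h3 := (remMellin_aux 0 a (s := s) (by simp; linarith)).1
  have heq : EqOn (fun x : ℝ => ((Phi x : ℝ) : ℂ) * (x : ℂ) ^ (s / 2 - 1))
      (fun x : ℝ => ((phiLead x : ℝ) : ℂ) * (x : ℂ) ^ (s / 2 - 1) +
        ((phiRem 0 x : ℝ) : ℂ) * (x : ℂ) ^ (s / 2 - 1)) (Ioc 0 a) := by
    intro x hx
    simp only [Phi_eq_phiLead_add hx.1]
    push_cast
    ring
  refine ⟨IntegrableOn.congr_fun (h1.add h3) heq.symm measurableSet_Ioc, ?_⟩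
  rw [setIntegral_congr_fun measurableSet_Ioc heq, integral_add h1 h3, h2, remMellin]

/-! ### The expansion with its removable singularities removed -/

/-- The function `1 / (Γ(s/2) (s + n - 1))`, with its removable singularity removed when `n` is
odd. -/
def recipQuot (n : ℕ) (s : ℂ) : ℂ :=
  -- For `n = 2k + 1`, `n / 2 = k` and `1/Γ(s/2)` is `∏_{j ≤ k} (s/2 + j)` times `1/Γ(s/2 + k + 1)`.
  -- The factor `j = k` equals `(s + n - 1)/2`; cancelling it leaves the final `1/2`.
  if Odd n then
    (∏ j ∈ Finset.range (n / 2), (s / 2 + j)) *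
      (Complex.Gamma (s / 2 + (n / 2 + 1 : ℕ)))⁻¹ / 2
  else (Complex.Gamma (s / 2))⁻¹ / (s + n - 1)

lemma inv_Gamma_eq_prod (z : ℂ) (k : ℕ) :
    (Complex.Gamma z)⁻¹ = (∏ j ∈ Finset.range k, (z + j)) * (Complex.Gamma (z + k))⁻¹ := by
  induction k with
  | zero => simp
  | succ k ih =>
    rw [ih, Finset.prod_range_succ, Complex.one_div_Gamma_eq_self_mul_one_div_Gamma_add_one (z + k)]
    push_cast
    rw [← add_assoc]
    ring

lemma recipQuot_eq {n : ℕ} {s : ℂ} (h : s + n - 1 ≠ 0) :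
    recipQuot n s = (Complex.Gamma (s / 2))⁻¹ / (s + n - 1) := by
  unfold recipQuot
  split_ifs with hn
  · obtain ⟨k, rfl⟩ := hn
    rw [inv_Gamma_eq_prod (s / 2) ((2 * k + 1) / 2 + 1), Finset.prod_range_succ,
      show (2 * k + 1) / 2 = k by omega, div_eq_div_iff two_ne_zero h]
    push_cast
    ring
  · rfl

lemma recipQuot_even {n : ℕ} (hn : ¬ Odd n) :
    recipQuot n = fun s => (Complex.Gamma (s / 2))⁻¹ / (s + n - 1) := by
  funext s; rw [recipQuot, if_neg hn]

lemma analyticAt_inv_Gamma_half (s : ℂ) :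
    AnalyticAt ℂ (fun s : ℂ => (Complex.Gamma (s / 2))⁻¹) s := by
  have : Differentiable ℂ (fun s : ℂ => (Complex.Gamma (s / 2))⁻¹) :=
    Complex.differentiable_one_div_Gamma.comp (differentiable_id.div_const 2)
  exact this.analyticAt s

lemma analyticAt_recipQuot {n : ℕ} {s : ℂ} (h : Odd n ∨ s + n - 1 ≠ 0) :
    AnalyticAt ℂ (recipQuot n) s := by
  by_cases hn : Odd n
  · have h1 : recipQuot n = fun s : ℂ => (∏ j ∈ Finset.range (n / 2), (s / 2 + j)) *
        (Complex.Gamma (s / 2 + (n / 2 + 1 : ℕ)))⁻¹ / 2 := by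
      funext s; rw [recipQuot, if_pos hn]
    have h2 : Differentiable ℂ (fun s : ℂ => (Complex.Gamma (s / 2 + (n / 2 + 1 : ℕ)))⁻¹) :=
      Complex.differentiable_one_div_Gamma.comp ((differentiable_id.div_const 2).add_const _)
    have h3 : Differentiable ℂ (fun s : ℂ => ∏ j ∈ Finset.range (n / 2), (s / 2 + (j : ℂ))) := by
      fun_prop
    rw [h1]
    exact ((h3.mul h2).div_const 2).analyticAt s
  · rw [recipQuot_even hn]
    have h1 : AnalyticAt ℂ (fun s : ℂ => s + n - 1) s := by fun_prop
    exact (analyticAt_inv_Gamma_half s).div h1 (h.resolve_left hn)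

/-- The point `s` is none of `1`, `-1`, `-3`, …. -/
def IsRegularPoint (s : ℂ) : Prop := s ≠ 1 ∧ ∀ n : ℕ, 1 ≤ n → s ≠ 1 - 2 * (n : ℂ)

lemma IsRegularPoint.odd_or {s : ℂ} (hs : IsRegularPoint s) (n : ℕ) : Odd n ∨ s + n - 1 ≠ 0 := by
  rcases Nat.even_or_odd' n with ⟨k, rfl | rfl⟩
  · right
    intro h
    have h2 : s = 1 - 2 * (k : ℂ) := by push_cast at h; linear_combination h
    rcases Nat.eq_zero_or_pos k with rfl | hk
    · exact hs.1 (by simpa using h2)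
    · exact hs.2 k hk h2
  · exact Or.inl ⟨k, rfl⟩

/-- The power of `a` and the constant in front of the expansion. -/
def prefactor (a : ℝ) (s : ℂ) : ℂ := (a : ℂ) ^ ((s - 1) / 2) / (4 * ((√π : ℝ) : ℂ))

/-- The `n`-th coefficient of the expansion. -/
def termCoeff (n : ℕ) (a : ℝ) : ℂ :=
  ((bernoulliCoeff n * ((4 * √a) ^ n * Gamma ((n : ℝ) / 2)) : ℝ) : ℂ)

/-- The constant `C₀ + log (16 π² a)`. -/
def logTerm (a : ℝ) : ℂ := ((eulerMascheroniConstant + Real.log (16 * π ^ 2 * a) : ℝ) : ℂ)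

/-- The leading term of the expansion, without the factor `(s - 1)⁻²`. -/
def leadTerm (a : ℝ) (s : ℂ) : ℂ :=
  prefactor a s * (Complex.Gamma (s / 2))⁻¹ * (-2 + logTerm a * (s - 1))

/-- The expansion with its removable singularities removed. -/
def regExpansion (N : ℕ) (a : ℝ) (s : ℂ) : ℂ :=
  leadTerm a s / (s - 1) ^ 2 +
    ∑ n ∈ Finset.Icc 1 N, prefactor a s * termCoeff n a * recipQuot n s

lemma singularExpansion_eq_regExpansion {N : ℕ} {a : ℝ} {s : ℂ} (hs : s ≠ 1)
    (h : ∀ n ∈ Finset.Icc 1 N, s + (n : ℂ) - 1 ≠ 0) :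
    singularExpansion N a s = regExpansion N a s := by
  have h1 : s - 1 ≠ 0 := sub_ne_zero.2 hs
  rw [singularExpansion, regExpansion, leadTerm, ← logTerm, mul_add, Finset.mul_sum]
  congr 1
  · rw [prefactor]
    field_simp
  · refine Finset.sum_congr rfl fun n hn => ?_
    rw [recipQuot_eq (h n hn), prefactor, termCoeff, bernoulliCoeff]
    push_cast
    ring

lemma analyticAt_prefactor {a : ℝ} (ha : 0 < a) (s : ℂ) : AnalyticAt ℂ (prefactor a) s := by
  have : Differentiable ℂ (prefactor a) := by
    unfold prefactor
    refine Differentiable.div_const ?_ _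
    exact Differentiable.const_cpow (by fun_prop) (Or.inl (Complex.ofReal_ne_zero.2 ha.ne'))
  exact this.analyticAt s

lemma prefactor_ne_zero {a : ℝ} (ha : 0 < a) (s : ℂ) : prefactor a s ≠ 0 := by
  refine div_ne_zero ?_ (mul_ne_zero (by norm_num) (Complex.ofReal_ne_zero.2 (by positivity)))
  simp [Complex.cpow_eq_zero_iff, ha.ne']

lemma analyticAt_leadTerm {a : ℝ} (ha : 0 < a) (s : ℂ) : AnalyticAt ℂ (leadTerm a) s := by
  have h : AnalyticAt ℂ (fun s : ℂ => -2 + logTerm a * (s - 1)) s := by fun_prop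
  exact ((analyticAt_prefactor ha s).mul (analyticAt_inv_Gamma_half s)).mul h

lemma analyticAt_term {a : ℝ} (ha : 0 < a) {n : ℕ} {s : ℂ} (h : Odd n ∨ s + n - 1 ≠ 0) :
    AnalyticAt ℂ (fun s => prefactor a s * termCoeff n a * recipQuot n s) s :=
  ((analyticAt_prefactor ha s).mul analyticAt_const).mul (analyticAt_recipQuot h)

lemma analyticAt_leadTerm_div {a : ℝ} (ha : 0 < a) {s : ℂ} (hs : s ≠ 1) :
    AnalyticAt ℂ (fun s => leadTerm a s / (s - 1) ^ 2) s := by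
  have h : AnalyticAt ℂ (fun s : ℂ => (s - 1) ^ 2) s := by fun_prop
  exact (analyticAt_leadTerm ha s).div h (pow_ne_zero 2 (sub_ne_zero.2 hs))

lemma analyticAt_sum_term {a : ℝ} (ha : 0 < a) {A : Finset ℕ} {s : ℂ}
    (h : ∀ n ∈ A, Odd n ∨ s + n - 1 ≠ 0) :
    AnalyticAt ℂ (fun s => ∑ n ∈ A, prefactor a s * termCoeff n a * recipQuot n s) s :=
  Finset.analyticAt_fun_sum A fun n hn => analyticAt_term ha (h n hn)

lemma analyticAt_regExpansion {a : ℝ} (ha : 0 < a) (N : ℕ) {s : ℂ} (hs : IsRegularPoint s) :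
    AnalyticAt ℂ (regExpansion N a) s :=
  (analyticAt_leadTerm_div ha hs.1).add (analyticAt_sum_term ha fun n _ => hs.odd_or n)

/-! ### Gluing the meromorphic continuation -/

/-- The expansion of length `N` together with its remainder. -/
def expansionWithRem (N : ℕ) (a : ℝ) (s : ℂ) : ℂ :=
  regExpansion N a s + (Complex.Gamma (s / 2))⁻¹ * remMellin N a s

lemma cpow_mul_sqrt_pow {a : ℝ} (ha : 0 < a) (N : ℕ) (s : ℂ) :
    (a : ℂ) ^ (((N : ℂ) + s) / 2) = (a : ℂ) ^ ((s - 1) / 2) * ((√a ^ (N + 1) : ℝ) : ℂ) := by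
  have h : √a ^ (N + 1) = a ^ (((N : ℝ) + 1) / 2) := by
    rw [sqrt_eq_rpow, ← rpow_natCast, ← rpow_mul ha.le]
    congr 1; push_cast; ring
  rw [h, Complex.ofReal_cpow ha.le, ← Complex.cpow_add _ _ (Complex.ofReal_ne_zero.2 ha.ne')]
  congr 1
  push_cast; ring

/-- The term gained by the expansion is exactly the one split off the remainder in
`remMellin_eq_add`. -/
lemma expansionWithRem_succ (N : ℕ) {a : ℝ} (ha : 0 < a) {s : ℂ} (hs : -(N : ℝ) < s.re) :
    expansionWithRem (N + 1) a s = expansionWithRem N a s := by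
  have hne : s + N ≠ 0 := by
    intro h
    have := congrArg Complex.re h
    simp at this
    linarith
  have hne' : s + (N + 1 : ℕ) - 1 ≠ 0 := by
    push_cast
    rwa [show s + (N + 1) - 1 = s + N by ring]
  rw [expansionWithRem, expansionWithRem, regExpansion, regExpansion,
    Finset.sum_Icc_succ_top (by omega), remMellin_eq_add N ha hs, recipQuot_eq hne', prefactor,
    termCoeff, cpow_mul_sqrt_pow ha, phiCoeff, mul_pow]
  have hpi : ((√π : ℝ) : ℂ) ≠ 0 := Complex.ofReal_ne_zero.2 (by positivity)
  push_cast
  rw [show s + (N + 1) - 1 = s + N by ring, add_comm (N : ℂ) s]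
  field_simp
  ring

lemma expansionWithRem_eq {M N : ℕ} (hMN : M ≤ N) {a : ℝ} (ha : 0 < a) {s : ℂ}
    (hs : -(M : ℝ) < s.re) : expansionWithRem N a s = expansionWithRem M a s := by
  induction N, hMN using Nat.le_induction with
  | base => rfl
  | succ N hN ih =>
    rw [expansionWithRem_succ N ha ?_, ih]
    have : (M : ℝ) ≤ N := by exact_mod_cast hN
    linarith

/-- The meromorphic continuation of `singularTerm a`. -/
def extS (a : ℝ) (s : ℂ) : ℂ := expansionWithRem (⌈|s.re|⌉₊ + 1) a s

lemma extS_eq {N : ℕ} {a : ℝ} (ha : 0 < a) {s : ℂ} (hs : -(N : ℝ) < s.re) :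
    extS a s = expansionWithRem N a s := by
  set M := ⌈|s.re|⌉₊ + 1 with hM
  have hMs : -(M : ℝ) < s.re := by
    have h1 := Nat.le_ceil |s.re|
    have h2 := neg_abs_le s.re
    rw [hM]; push_cast; linarith
  rw [extS, ← hM]
  rcases le_total M N with h | h
  · exact (expansionWithRem_eq h ha hMs).symm
  · exact expansionWithRem_eq h ha hs

/-- The length in `extS` jumps with `s`; near a given point it may be frozen, which reduces local
analysis to a single `expansionWithRem N a`. -/
lemma extS_eventuallyEq {N : ℕ} {a : ℝ} (ha : 0 < a) {s : ℂ} (hs : -(N : ℝ) < s.re) :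
    extS a =ᶠ[𝓝 s] expansionWithRem N a := by
  have hopen : IsOpen {q : ℂ | -(N : ℝ) < q.re} :=
    isOpen_lt continuous_const Complex.continuous_re
  filter_upwards [hopen.mem_nhds hs] with z hz
  exact extS_eq ha hz

lemma analyticAt_remTerm {N : ℕ} (a : ℝ) {s : ℂ} (hs : -(N : ℝ) < s.re) :
    AnalyticAt ℂ (fun s => (Complex.Gamma (s / 2))⁻¹ * remMellin N a s) s :=
  (analyticAt_inv_Gamma_half s).mul (analyticAt_remMellin N a hs)

lemma exists_neg_natCast_lt (s : ℂ) : ∃ N : ℕ, -(N : ℝ) < s.re := by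
  obtain ⟨N, hN⟩ := exists_nat_gt (-s.re)
  exact ⟨N, by linarith⟩

lemma analyticAt_extS {a : ℝ} (ha : 0 < a) {s : ℂ} (hs : IsRegularPoint s) :
    AnalyticAt ℂ (extS a) s := by
  obtain ⟨N, hN⟩ := exists_neg_natCast_lt s
  refine AnalyticAt.congr ?_ (extS_eventuallyEq ha hN).symm
  exact (analyticAt_regExpansion ha N hs).add (analyticAt_remTerm a hN)

lemma extS_eq_singularTerm {a : ℝ} (ha : 0 < a) {s : ℂ} (hs : 1 < s.re) :
    extS a s = singularTerm a s := by
  have hs1 : s - 1 ≠ 0 := by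
    intro h
    have := congrArg Complex.re h
    simp at this
    linarith
  rw [extS_eq (N := 0) ha (by simp; linarith), singularTerm, (integral_Phi_mul_cpow ha hs).2,
    expansionWithRem, regExpansion, leadTerm, prefactor, ← logTerm]
  simp only [Finset.Icc_eq_empty_of_lt zero_lt_one, Finset.sum_empty, add_zero]
  field_simp

/-! ### Orders of the poles -/

lemma meromorphicOrderAt_eq_neg {f A B : ℂ → ℂ} {p : ℂ} {k : ℕ} (hk : k ≠ 0)
    (hA : AnalyticAt ℂ A p) (hB : AnalyticAt ℂ B p) (hBp : B p ≠ 0)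
    (hf : ∀ᶠ z in 𝓝[≠] p, f z = A z + B z / (z - p) ^ k) :
    MeromorphicAt f p ∧ meromorphicOrderAt f p = ((-(k : ℤ) : ℤ) : WithTop ℤ) := by
  have hg : AnalyticAt ℂ (fun z => (z - p) ^ k * A z + B z) p := by fun_prop
  have hfg : ∀ᶠ z in 𝓝[≠] p, f z = (z - p) ^ (-(k : ℤ)) • ((z - p) ^ k * A z + B z) := by
    filter_upwards [hf, self_mem_nhdsWithin] with z hz hzp
    have : z - p ≠ 0 := sub_ne_zero.2 hzp
    rw [hz, zpow_neg, zpow_natCast, smul_eq_mul]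
    field_simp
  have hmer : MeromorphicAt f p := by
    have h1 : MeromorphicAt (fun z => (z - p) ^ (-(k : ℤ)) • ((z - p) ^ k * A z + B z)) p := by
      have h2 : MeromorphicAt (fun z : ℂ => z - p) p := by fun_prop
      exact (h2.zpow _).smul hg.meromorphicAt
    exact h1.congr (hfg.mono fun z hz => hz.symm)
  refine ⟨hmer, (meromorphicOrderAt_eq_int_iff hmer).2 ⟨_, hg, ?_, hfg⟩⟩
  simpa [hk] using hBp

lemma order_extS_one {a : ℝ} (ha : 0 < a) :
    MeromorphicAt (extS a) 1 ∧ meromorphicOrderAt (extS a) 1 = ((-2 : ℤ) : WithTop ℤ) := by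
  have hN : -((0 : ℕ) : ℝ) < (1 : ℂ).re := by simp
  refine meromorphicOrderAt_eq_neg (k := 2) two_ne_zero (analyticAt_remTerm a hN)
    (analyticAt_leadTerm ha 1) ?_ ?_
  · rw [leadTerm]
    refine mul_ne_zero (mul_ne_zero (prefactor_ne_zero ha 1) (inv_ne_zero ?_)) (by simp)
    exact Complex.Gamma_ne_zero_of_re_pos (by simp)
  · refine ((extS_eventuallyEq ha hN).filter_mono nhdsWithin_le_nhds).mono fun z hz => ?_
    rw [hz, expansionWithRem, regExpansion]
    simp only [Finset.Icc_eq_empty_of_lt zero_lt_one, Finset.sum_empty, add_zero]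
    ring

lemma bernoulliFun_three_quarters (n : ℕ) :
    bernoulliFun n (3 / 4) = (((Polynomial.bernoulli n).eval (3 / 4 : ℚ) : ℚ) : ℝ) := by
  rw [bernoulliFun, Polynomial.eval_map_algebraMap]
  have := Polynomial.aeval_algebraMap_apply ℝ (3 / 4 : ℚ) (Polynomial.bernoulli n)
  simpa using this

/-- By Euler's formula a zero would force `∑ 1/n^(2k) = 0`, a sum of nonnegative terms whose term at
`1` is `1`. -/
lemma bernoulli_two_mul_ne_zero {k : ℕ} (hk : k ≠ 0) : bernoulli (2 * k) ≠ 0 := by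
  intro h
  have h1 := hasSum_zeta_nat hk
  rw [h] at h1
  simp only [Rat.cast_zero, mul_zero, zero_div] at h1
  have h2 := (hasSum_zero_iff_of_nonneg (fun n => by positivity)).1 h1
  have := congrFun h2 1
  simp at this

/-- The multiplication formula relates `B(1/4) + B(3/4)` to `B(1/2)`, and for even index symmetry
gives `B(1/4) = B(3/4)`. Since `B_{2k}(1/2) = (2^(1-2k) - 1) B_{2k}` is nonzero, so is the value at
`3/4`. -/
lemma bernoulliCoeff_two_mul_ne_zero {k : ℕ} (hk : k ≠ 0) : bernoulliCoeff (2 * k) ≠ 0 := by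
  have h1 := bernoulliFun_mul (2 * k) two_ne_zero (1 / 4)
  have h2 := bernoulliFun_eval_half (2 * k)
  have h3 := bernoulliFun_eval_one_sub (k := 2 * k) (x := 1 / 4)
  rw [pow_mul, neg_one_sq, one_pow, one_mul] at h3
  have h4 : (2 : ℝ) / 2 ^ (2 * k) - 1 ≠ 0 := by
    have h5 : (2 : ℝ) ^ 2 ≤ 2 ^ (2 * k) := pow_le_pow_right₀ (by norm_num) (by omega)
    have h6 : (2 : ℝ) / 2 ^ (2 * k) < 1 := by rw [div_lt_one (by positivity)]; linarith
    linarith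
  have h5 : (bernoulli (2 * k) : ℝ) ≠ 0 := by exact_mod_cast bernoulli_two_mul_ne_zero hk
  intro h
  have h7 : bernoulliFun (2 * k) (3 / 4) = 0 := by
    rw [bernoulliFun_three_quarters]
    rw [bernoulliCoeff, div_eq_zero_iff] at h
    exact h.resolve_right (by positivity)
  norm_num [Finset.sum_range_succ] at h1 h2 h3
  rw [← h3, h7, h2] at h1
  simp only [add_zero, mul_zero] at h1
  exact mul_ne_zero h4 h5 h1

lemma order_extS_neg {a : ℝ} (ha : 0 < a) {k : ℕ} (hk : 1 ≤ k) :
    MeromorphicAt (extS a) (1 - 2 * (k : ℂ)) ∧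
      meromorphicOrderAt (extS a) (1 - 2 * (k : ℂ)) = ((-1 : ℤ) : WithTop ℤ) := by
  set p : ℂ := 1 - 2 * (k : ℂ) with hp
  have hpre : p.re = 1 - 2 * k := by simp [hp]
  -- Length `2k` is the least whose half-plane contains `p`; only its last term `n = 2k` is singular
  -- there.
  have hN : -((2 * k : ℕ) : ℝ) < p.re := by rw [hpre]; push_cast; linarith
  have hp1 : p ≠ 1 := by
    intro h
    rw [h] at hpre
    have : (1 : ℝ) ≤ k := by exact_mod_cast hk
    simp at hpre
    linarith
  have hmem : 2 * k ∈ Finset.Icc 1 (2 * k) := Finset.mem_Icc.2 ⟨by omega, le_rfl⟩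
  have hA := (((analyticAt_leadTerm_div ha hp1).add
    (analyticAt_sum_term ha (A := (Finset.Icc 1 (2 * k)).erase (2 * k)) (s := p) ?_))).add
    (analyticAt_remTerm a hN)
  · have hB : AnalyticAt ℂ (fun s => prefactor a s * termCoeff (2 * k) a *
        (Complex.Gamma (s / 2))⁻¹) p :=
      ((analyticAt_prefactor ha p).mul analyticAt_const).mul (analyticAt_inv_Gamma_half p)
    refine meromorphicOrderAt_eq_neg (k := 1) one_ne_zero hA hB ?_ ?_
    · refine mul_ne_zero (mul_ne_zero (prefactor_ne_zero ha p) ?_) (inv_ne_zero ?_)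
      · refine Complex.ofReal_ne_zero.2 (mul_ne_zero (bernoulliCoeff_two_mul_ne_zero (by omega)) ?_)
        have : 0 < Gamma (((2 * k : ℕ) : ℝ) / 2) := Gamma_pos_of_pos (by positivity)
        positivity
      -- A pole of `Γ` at `p/2` would make the odd number `1 - 2k` equal to `-2m`.
      · refine Complex.Gamma_ne_zero fun m hm => ?_
        have h1 : (1 - 2 * (k : ℂ)) + 2 * m = 0 := by rw [← hp]; linear_combination 2 * hm
        have h2 : (1 - 2 * (k : ℤ)) + 2 * m = 0 := by exact_mod_cast h1
        omega
    · refine ((extS_eventuallyEq ha hN).filter_mono nhdsWithin_le_nhds).mono fun z hz => ?_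
      rw [hz, expansionWithRem, regExpansion, ← Finset.add_sum_erase _ _ hmem,
        recipQuot_even (by simp : ¬ Odd (2 * k))]
      simp only [Pi.add_apply]
      rw [pow_one, show z + (2 * k : ℕ) - 1 = z - p by rw [hp]; push_cast; ring]
      ring
  · intro n hn
    by_cases h : p + n - 1 = 0
    · exfalso
      have h1 : (n : ℂ) = (2 * k : ℕ) := by rw [hp] at h; push_cast; linear_combination h
      exact (Finset.mem_erase.1 hn).1 (by exact_mod_cast h1)
    · exact Or.inr h

/-! ### The asymptotic expansion as `a → 0⁺` -/

lemma isBigO_extS_sub_regExpansion {N : ℕ} {s : ℂ} (hs : -(N : ℝ) - 1 < s.re) :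
    (fun a : ℝ => extS a s - regExpansion N a s) =O[𝓝[>] 0]
      (fun a : ℝ => a ^ (((N : ℝ) + s.re) / 2)) := by
  -- The half-plane `Re s > -N - 1` requires length `N + 1`. The additional term has modulus `K`
  -- times `a^((N+σ)/2)`, and for `a < 1` the remainder is smaller by a factor `√a`.
  have hs' : -((N + 1 : ℕ) : ℝ) < s.re := by push_cast; linarith
  obtain ⟨C, hC⟩ := exists_norm_remMellin_le (N + 1) hs'
  have hC0 : 0 ≤ C := by
    have := (norm_nonneg _).trans (hC 1 one_pos)
    simpa using this
  set K : ℝ := ‖((bernoulliCoeff (N + 1) * (4 ^ (N + 1) * Gamma (((N + 1 : ℕ) : ℝ) / 2)) : ℝ) : ℂ) /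
    (4 * ((√π : ℝ) : ℂ)) * recipQuot (N + 1) s‖ with hK
  refine Asymptotics.IsBigO.of_bound (K + ‖(Complex.Gamma (s / 2))⁻¹‖ * C) ?_
  filter_upwards [Ioo_mem_nhdsGT (one_pos (α := ℝ))] with a ha
  have ha0 : 0 < a := ha.1
  have h1 : extS a s - regExpansion N a s =
      (a : ℂ) ^ (((N : ℂ) + s) / 2) *
        (((bernoulliCoeff (N + 1) * (4 ^ (N + 1) * Gamma (((N + 1 : ℕ) : ℝ) / 2)) : ℝ) : ℂ) /
        (4 * ((√π : ℝ) : ℂ)) * recipQuot (N + 1) s) +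
      (Complex.Gamma (s / 2))⁻¹ * remMellin (N + 1) a s := by
    rw [extS_eq ha0 hs', expansionWithRem, regExpansion, regExpansion,
      Finset.sum_Icc_succ_top (by omega), cpow_mul_sqrt_pow ha0, prefactor, termCoeff, mul_pow]
    push_cast
    ring
  have h2 : ‖(a : ℂ) ^ (((N : ℂ) + s) / 2)‖ = a ^ (((N : ℝ) + s.re) / 2) := by
    rw [Complex.norm_cpow_eq_rpow_re_of_pos ha0, half_add_re]
  have h3 : ‖remMellin (N + 1) a s‖ ≤ C * a ^ (((N : ℝ) + s.re) / 2) := by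
    refine (hC a ha0).trans (mul_le_mul_of_nonneg_left ?_ hC0)
    refine rpow_le_rpow_of_exponent_ge ha0 ha.2.le ?_
    push_cast; linarith
  rw [h1, norm_of_nonneg (rpow_nonneg ha0.le _), add_mul]
  refine (norm_add_le _ _).trans (add_le_add ?_ ?_)
  · rw [norm_mul, h2, ← hK, mul_comm]
  · rw [norm_mul, mul_assoc]
    exact mul_le_mul_of_nonneg_left h3 (norm_nonneg _)

/-- The finitely many denominators have no zero in a small punctured neighbourhood of `s`, where the
literal expansion coincides with one analytic at `s`. -/
lemma tendsto_singularExpansion {a : ℝ} (ha : 0 < a) (N : ℕ) {s : ℂ} (hs : IsRegularPoint s) :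
    Tendsto (fun z : ℂ => singularExpansion N a z) (𝓝[≠] s) (𝓝 (regExpansion N a s)) := by
  have h1 := (analyticAt_regExpansion ha N hs).continuousAt.tendsto.mono_left
    (nhdsWithin_le_nhds (s := {s}ᶜ))
  refine h1.congr' ?_
  have h2 : ∀ᶠ z in 𝓝[≠] s, z ≠ 1 :=
    (eventually_ne_nhds hs.1).filter_mono nhdsWithin_le_nhds
  have h3 : ∀ᶠ z in 𝓝[≠] s, ∀ n ∈ Finset.Icc 1 N, z + (n : ℂ) - 1 ≠ 0 := by
    rw [Filter.eventually_all_finset]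
    intro n _
    by_cases h : s = 1 - n
    · filter_upwards [self_mem_nhdsWithin] with z hz h0
      exact hz (by rw [mem_singleton_iff, h]; linear_combination h0)
    · filter_upwards [(eventually_ne_nhds h).filter_mono nhdsWithin_le_nhds] with z hz h0
      exact hz (by linear_combination h0)
  filter_upwards [h2, h3] with z hz hz'
  exact (singularExpansion_eq_regExpansion hz hz').symm

lemma meromorphic_extS {a : ℝ} (ha : 0 < a) : Meromorphic (extS a) := by
  intro s
  by_cases h1 : s = 1
  · exact h1 ▸ (order_extS_one ha).1
  · by_cases h2 : ∀ n : ℕ, 1 ≤ n → s ≠ 1 - 2 * (n : ℂ)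
    · exact (analyticAt_extS ha ⟨h1, h2⟩).meromorphicAt
    · push Not at h2
      obtain ⟨n, hn, rfl⟩ := h2
      exact (order_extS_neg ha hn).1

end SecondZeta

end

theorem mainTheorem2 :
    -- the integrals defining `Φ(x)`, `x > 0`, and `S(s)`, `Re s > 1`, converge absolutely
    (∀ x : ℝ, 0 < x →
      MeasureTheory.IntegrableOn (fun t : ℝ => Real.exp (-x * t ^ 2) * SecondZeta.Psi t)
        (Set.Ioi (0 : ℝ))) ∧
    (∀ a : ℝ, 0 < a → ∀ s : ℂ, 1 < s.re →
      MeasureTheory.IntegrableOn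
        (fun x : ℝ => ((SecondZeta.Phi x : ℝ) : ℂ) * (x : ℂ) ^ (s / 2 - 1))
        (Set.Ioc (0 : ℝ) a)) ∧
    ∃ S : ℝ → ℂ → ℂ,
      -- for each `a > 0`, `S a` is a meromorphic extension of the singular term whose poles
      -- are exactly `1` (double) and `1 - 2n`, `n ≥ 1` (simple)
      (∀ a : ℝ, 0 < a →
        Meromorphic (S a) ∧
        (∀ s : ℂ, 1 < s.re → S a s = SecondZeta.singularTerm a s) ∧
        meromorphicOrderAt (S a) 1 = ((-2 : ℤ) : WithTop ℤ) ∧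
        (∀ n : ℕ, 1 ≤ n →
          meromorphicOrderAt (S a) (1 - 2 * (n : ℂ)) = ((-1 : ℤ) : WithTop ℤ)) ∧
        (∀ s : ℂ, s ≠ 1 → (∀ n : ℕ, 1 ≤ n → s ≠ 1 - 2 * (n : ℂ)) → AnalyticAt ℂ (S a) s)) ∧
      -- the expansion as `a → 0⁺`, at every `s` with `Re s > -N-1` that is not a pole
      (∀ (N : ℕ) (s : ℂ), -(N : ℝ) - 1 < s.re → s ≠ 1 →
        (∀ n : ℕ, 1 ≤ n → s ≠ 1 - 2 * (n : ℂ)) →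
        -- literally, where no denominator vanishes
        ((∀ n ∈ Finset.Icc 1 N, s + (n : ℂ) - 1 ≠ 0) →
          Asymptotics.IsBigO (nhdsWithin (0 : ℝ) (Set.Ioi 0))
            (fun a : ℝ => S a s - SecondZeta.singularExpansion N a s)
            (fun a : ℝ => a ^ (((N : ℝ) + s.re) / 2))) ∧
        -- in general (in particular at `s = 0, -2, -4, …`), with the expansion replaced by its
        -- limit at `s`, a removable singularity
        (∃ m : ℝ → ℂ,
          (∀ a : ℝ, 0 < a →
            Filter.Tendsto (fun z : ℂ => SecondZeta.singularExpansion N a z)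
              (nhdsWithin s {s}ᶜ) (nhds (m a))) ∧
          Asymptotics.IsBigO (nhdsWithin (0 : ℝ) (Set.Ioi 0))
            (fun a : ℝ => S a s - m a)
            (fun a : ℝ => a ^ (((N : ℝ) + s.re) / 2)))) := by
  refine ⟨fun x hx => SecondZeta.integrableOn_gaussian_mul_Psi hx,
    fun a ha s hs => (SecondZeta.integral_Phi_mul_cpow ha hs).1,
    SecondZeta.extS, fun a ha => ⟨SecondZeta.meromorphic_extS ha,
      fun s hs => SecondZeta.extS_eq_singularTerm ha hs, (SecondZeta.order_extS_one ha).2,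
      fun n hn => (SecondZeta.order_extS_neg ha hn).2,
      fun s h1 h2 => SecondZeta.analyticAt_extS ha ⟨h1, h2⟩⟩, fun N s hs h1 h2 => ⟨fun h => ?_,
      fun a => SecondZeta.regExpansion N a s,
      fun a ha => SecondZeta.tendsto_singularExpansion ha N ⟨h1, h2⟩,
      SecondZeta.isBigO_extS_sub_regExpansion hs⟩⟩
  simp only [SecondZeta.singularExpansion_eq_regExpansion h1 h]
  exact SecondZeta.isBigO_extS_sub_regExpansion hs
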